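/- Let $d\ge 0$ be an integer, $N=2^d$, and let $J=\bigcup_{n\ge 0}\{1,\dots,N\}^n$ be the $N$-ary tree of finite words, with generation $|j|$, order $k\le j$ ($k$ is a prefix of $j$), father $\bar\jmath$ and offspring $\mathcal O_j$. To $j\in J$ associate the closed dyadic cube $Q_j\subset Q_\emptyset=[0,1]^d$ of side $2^{-|j|}$, the $N$ children of $j$ corresponding, in a fixed order, to the $N$ half-size subcubes of $Q_j$. For $x\in Q_\emptyset$ let $(x_n)_{n\ge0}$ be the sequence of nodes $\emptyset=x_0<x_1<\dots$ with $|x_n|=n$ and $x\in Q_{x_n}$; it is unique if $x$ lies on the boundary of no dyadic cube, and for the remaining points $x$ either any such sequence is chosen or the point $x$ is discarded (the results hold for every such convention). Let $(d_j)_{j\in J}$ be repeated coefficients: $d_\emptyset=1$ and there are numbers $\delta_\omega>0$, $\omega\in\Omega$, $|\Omega|=N$, such that for every $j$ the family $\{d_k:k\in\mathcal O_j\}$, counted with multiplicities, is $\{\delta_\omega:\omega\in\Omega\}$. Fix labels $\omega(k)\in\Omega$ for $k\ne\emptyset$ such that $d_k=\delta_{\omega(k)}$ and $k\mapsto\omega(k)$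 is a bijection $\mathcal O_j\to\Omega$ for every $j$. The model is flat if all $\delta_\omega$ are equal. Define $\ell_s=\frac1s\log_2\bigl(\frac1N\sum_\omega\delta_\omega^s\bigr)$ for $s\neq0$, $\ell_0=\frac1N\sum_\omega\log_2\delta_\omega$, $\ell_{-\infty}=\min_\omega\log_2\delta_\omega$, $\ell_{+\infty}=\max_\omega\log_2\delta_\omega$, and $$\varphi(\gamma)=\sum_\omega\frac{\delta_\omega^\gamma}{\sum_v\delta_v^\gamma}\log_2\delta_\omega .$$ On the simplex $S$ of probability vectors $p=(p_\omega)_{\omega\in\Omega}$ let $H(p)=-\sum_\omega p_\omega\log_2p_\omega$ and $\sigma(p)=\sum_\omega p_\omega\log_2\delta_\omega$; let $\mathbb S_a=\{p\in S:\sigma(p)=a\}$ and $\mathcal D(a)=\sup_{p\in\mathbb S_a}H(p)$. Let $\pi_\omega(j)=\frac1{|j|}\#\{k:\emptyset\neq k\le j,\ \omega(k)=\omega\}$, let $A(x)$ be the set of accumulation points (subsequential limits) of the sequence $(\pi(x_n))_{n}$ in $\mathbb R^\Omega$, and let $E(\mathbb S_a)=\{x: A(x)\subseteq\mathbb S_a\}$.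 Then: 1. For all $a\in[\ell_{-\infty},\ell_{+\infty}]$ the supremum $\mathcal D(a)$ is a maximum and $\dim_{\mathrm{Haus}}E(\mathbb S_a)=\mathcal D(a)$. For $a\in(\ell_{-\infty},\ell_{+\infty})$ there is exactly one $\gamma_a\in\mathbb R$ with $\varphi(\gamma_a)=a$, and $\mathcal D(a)=d-\gamma_a(a-\ell_{\gamma_a})$. If the model is flat, then $\ell_{-\infty}=\ell_{+\infty}$ and $\mathcal D(\ell_{-\infty})=d$. 2. Let $\alpha>0$, $f>0$, $c_j=d_j2^{\alpha|j|}$, and let $u=(u_j)_{j\in J}$ be the constant componentwise solution of the model $v_j'=c_jv_{\bar\jmath}^2-\sum_{k\in\mathcal O_j}c_kv_jv_k$, that is, $u_j\ge0$, $0=c_ju_{\bar\jmath}^2-\sum_{k\in\mathcal O_j}c_ku_ju_k$ for all $j$, with $u_{\bar\emptyset}=f$, and $\sum_j2^{2s|j|}u_j^2<\infty$ for some $s\in\mathbb R$. Let $F_j=\dfrac{2c_ju_{\bar\jmath}^2u_j}{2c_\emptyset u_{\bar\emptyset}^2u_\emptyset}$ be the fraction of anomalous dissipation in $Q_j$ and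 $\sigma_j=\frac1{|j|}\sum_{k\le j}\log_2d_k$. Then $a=\varphi(3/2)$ is the one and only value $a\in\mathbb R$ that carries all anomalous dissipation, in the sense that for every neighbourhood $B$ of $a$ $$\lim_{n\to\infty}\sum_{|j|=n}F_j\,\mathbf 1_{\sigma_j\in B}=1 .$$ 3. The corresponding set $E(\mathbb S_{\varphi(3/2)})$, on which anomalous dissipation occurs, has Hausdorff dimension $$\Delta=d-\tfrac32\bigl(\varphi(3/2)-\ell_{3/2}\bigr)\ge0,$$ and $\Delta<d$ if the model is not flat. -/

import Mathlib

open Filter Topology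

noncomputable section

namespace DyadicTree

/-- The `2 ^ d` children of a node, indexed by the position of the corresponding half-size cube. -/
abbrev Digit (d : ℕ) : Type := Fin d → Fin 2

/-- The nodes of the `2 ^ d`-ary tree: finite words, the root being the empty word.
The generation of `j` is `j.length`, its ancestors (`k ≤ j`) are the words `j.take m` with
`m ≤ j.length`, its father is `j.dropLast` and its offspring are the words `j ++ [i]`. -/
abbrev Node (d : ℕ) : Type := List (Digit d)

/-- The lower corner of the dyadic cube of a node. -/
def corner {d : ℕ} (j : Node d) (c : Fin d) : ℝ :=
  ∑ m : Fin j.length, (((j.get m) c : ℕ) : ℝ) / 2 ^ ((m : ℕ) + 1)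

/-- The closed dyadic cube `Q_j` of side `2 ^ (-|j|)` of a node `j`. -/
def cube {d : ℕ} (j : Node d) : Set (EuclideanSpace ℝ (Fin d)) :=
  {x | ∀ c, corner j c ≤ x c ∧ x c ≤ corner j c + 1 / 2 ^ j.length}

/-- The node of generation `n` along an infinite branch of the tree. -/
def branch {d : ℕ} (ξ : ℕ → Digit d) (n : ℕ) : Node d :=
  List.ofFn (fun m : Fin n => ξ m)

/-- The identification of a point `x` of the unit cube with the branch `(x_n)` of the tree such
that `x ∈ Q_{x_n}` for all `n`. The branch is uniquely determined when `x` lies on the boundary of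
no dyadic cube. For the other points any convention is allowed: they may be discarded, or any
branch whose cubes all contain the point may be chosen. -/
structure Coding (d : ℕ) where
  /-- the points to which a branch is attached -/
  dom : Set (EuclideanSpace ℝ (Fin d))
  /-- the branch attached to a point -/
  digits : EuclideanSpace ℝ (Fin d) → ℕ → Digit d
  dom_subset : dom ⊆ cube ([] : Node d)
  generic_mem : ∀ x ∈ cube ([] : Node d), (∀ j : Node d, x ∉ frontier (cube j)) → x ∈ dom
  mem_cube : ∀ x ∈ dom, ∀ n, x ∈ cube (branch (digits x) n)

/-- The node `x_n`. -/
def Coding.node {d : ℕ} (X : Coding d) (x : EuclideanSpace ℝ (Fin d)) (n : ℕ) : Node d :=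
  branch (X.digits x) n

/-- Repeated coefficients: positive numbers `d_j` on the nodes of the tree, equal to `1` at the
root, such that the family of the values of `d` on the offspring of `j` is, for every `j`, the same
family `δ` up to a relabelling (which may depend on `j`). The relabelling is recorded in `label`, so
that equal values of `δ` with different labels are told apart (values are counted with
multiplicity); the label of the root is irrelevant. -/
structure RCM (d : ℕ) (Ω : Type*) where
  /-- the coefficients `d_j` -/
  coeff : Node d → ℝ
  /-- the repeated values -/
  δ : Ω → ℝ
  /-- the label in `Ω` of a node other than the root -/
  label : Node d → Ω
  δ_pos : ∀ ω, 0 < δ ω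
  coeff_nil : coeff [] = 1
  label_bijective : ∀ j : Node d, Function.Bijective (fun i : Digit d => label (j ++ [i]))
  coeff_append : ∀ (j : Node d) (i : Digit d), coeff (j ++ [i]) = δ (label (j ++ [i]))

/-- The value of `u` at the father of `j`, the father of the root carrying the forcing `f`. -/
def fatherValue {d : ℕ} (f : ℝ) (u : Node d → ℝ) (j : Node d) : ℝ :=
  if j = [] then f else u j.dropLast

/-- `u` belongs to the space `H^s` of functions on the tree. -/
def MemH {d : ℕ} (s : ℝ) (u : Node d → ℝ) : Prop :=
  Summable (fun j : Node d => (2 : ℝ) ^ (2 * s * (j.length : ℝ)) * u j ^ 2)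

/-- The binary entropy function of a vector (with `0 log 0 = 0`). -/
def entropy {Ω : Type*} [Fintype Ω] (p : Ω → ℝ) : ℝ :=
  -∑ ω, p ω * Real.logb 2 (p ω)

namespace RCM

variable {d : ℕ} {Ω : Type*}

/-- All the repeated coefficients are equal. -/
def Flat (M : RCM d Ω) : Prop := ∀ ω ω', M.δ ω = M.δ ω'

/-- `c_j = d_j 2 ^ (α |j|)`. -/
def c (M : RCM d Ω) (α : ℝ) (j : Node d) : ℝ :=
  M.coeff j * (2 : ℝ) ^ (α * (j.length : ℝ))

/-- `u` is a constant (time-independent) componentwise solution of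
`v_j' = c_j v_{father j} ^ 2 - ∑_{k child of j} c_k v_j v_k`, with forcing `f` above the root. -/
def IsConstantSolution (M : RCM d Ω) (α f : ℝ) (u : Node d → ℝ) : Prop :=
  (∀ j, 0 ≤ u j) ∧
    ∀ j, 0 = M.c α j * fatherValue f u j ^ 2 -
      ∑ i : Digit d, M.c α (j ++ [i]) * u j * u (j ++ [i])

/-- The fraction `F_j` of anomalous dissipation in the cube `Q_j`: the energy flow from the father
of `j` to `j` over the energy flow into the root. -/
def dissipation (M : RCM d Ω) (α f : ℝ) (u : Node d → ℝ) (j : Node d) : ℝ :=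
  (2 * M.c α j * fatherValue f u j ^ 2 * u j) /
    (2 * M.c α [] * fatherValue f u [] ^ 2 * u [])

/-- `σ_j`, the mean over the ancestors of `j` of the logarithms of the coefficients. -/
def sigmaNode (M : RCM d Ω) (j : Node d) : ℝ :=
  (∑ m ∈ Finset.range (j.length + 1), Real.logb 2 (M.coeff (j.take m))) / (j.length : ℝ)

/-- All anomalous dissipation is carried by the value `a` of `σ`: for every neighbourhood `B` of
`a`, the fraction of dissipation in the cubes of generation `n` with `σ_j ∈ B` tends to `1`. -/
def CarriesDissipation (M : RCM d Ω) (α f : ℝ) (u : Node d → ℝ) (a : ℝ) : Prop :=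
  ∀ B ∈ 𝓝 a, Tendsto
    (fun n : ℕ => ∑ j : Fin n → Digit d,
      B.indicator (fun _ => M.dissipation α f u (List.ofFn j)) (M.sigmaNode (List.ofFn j)))
    atTop (𝓝 1)

open Classical in
/-- `π_ω(j)`, the frequency of the label `ω` among the ancestors of `j` other than the root. -/
def freq (M : RCM d Ω) (j : Node d) (ω : Ω) : ℝ :=
  (((Finset.range j.length).filter (fun m => M.label (j.take (m + 1)) = ω)).card : ℝ) /
    (j.length : ℝ)

/-- `A(x)`, the accumulation points of the sequence `(π(x_n))_n`. -/
def accFreq (M : RCM d Ω) (X : Coding d) (x : EuclideanSpace ℝ (Fin d)) : Set (Ω → ℝ) :=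
  {p | MapClusterPt p atTop (fun n : ℕ => M.freq (X.node x n))}

variable [Fintype Ω]

/-- The linear function `σ(p)`. -/
def sigma (M : RCM d Ω) (p : Ω → ℝ) : ℝ := ∑ ω, p ω * Real.logb 2 (M.δ ω)

/-- `𝕊_a`, the probability vectors `p` with `σ(p) = a`. -/
def level (M : RCM d Ω) (a : ℝ) : Set (Ω → ℝ) :=
  {p | p ∈ stdSimplex ℝ Ω ∧ M.sigma p = a}

/-- `E(𝕊_a)`, the points all of whose asymptotic frequencies are in `𝕊_a`. -/
def E (M : RCM d Ω) (X : Coding d) (a : ℝ) : Set (EuclideanSpace ℝ (Fin d)) :=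
  {x | x ∈ X.dom ∧ M.accFreq X x ⊆ M.level a}

/-- `𝒟(a)`, the supremum of the entropy on `𝕊_a`. -/
def D (M : RCM d Ω) (a : ℝ) : ℝ := sSup (entropy '' M.level a)

/-- `ℓ_s`, with its limit value at `s = 0`. -/
def ell (M : RCM d Ω) (s : ℝ) : ℝ :=
  if s = 0 then (∑ ω, Real.logb 2 (M.δ ω)) / 2 ^ d
  else 1 / s * Real.logb 2 ((∑ ω, M.δ ω ^ s) / 2 ^ d)

/-- `ℓ_{-∞}`, the limit of `ℓ_s` at `-∞`. -/
def ellBot (M : RCM d Ω) : ℝ := ⨅ ω, Real.logb 2 (M.δ ω)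

/-- `ℓ_{+∞}`, the limit of `ℓ_s` at `+∞`. -/
def ellTop (M : RCM d Ω) : ℝ := ⨆ ω, Real.logb 2 (M.δ ω)

/-- The function `φ`. -/
def phi (M : RCM d Ω) (γ : ℝ) : ℝ :=
  ∑ ω, M.δ ω ^ γ / (∑ v, M.δ v ^ γ) * Real.logb 2 (M.δ ω)

/-- `Δ = d - 3/2 (φ(3/2) - ℓ_{3/2})`. -/
def Delta (M : RCM d Ω) : ℝ := d - 3 / 2 * (M.phi (3 / 2) - M.ell (3 / 2))

end RCM

end DyadicTree

end

/-!
The proof rests on the product weights `weight p`, which split the mass of a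
cube among its offspring in the proportions `p` of their labels, whatever the labelling of the
individual nodes.

*Entropy.* Gibbs' inequality against the vector `gibbs γ` proportional to `δ ^ γ` gives
`H(p) ≤ pressure γ - γ a` for all `p ∈ 𝕊_a` and all `γ`, with equality for `p = gibbs γ` when
`φ γ = a`. The derivative of the pressure is `φ`, so for `a` strictly between the extreme values a
minimiser of the coercive function `pressure γ - γ a` solves `φ γ = a`; at an extreme value the
infimum over `γ` is the entropy of the uniform vector on the extreme labels. Hence on every level
the maximal entropy is `inf_γ (pressure γ - γ a)` (`RCM.exists_entropy_eq`).

*Dimension.* Along the branch of a point of `E(𝕊_a)` the weights for `gibbs γ` decay at the rate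
`pressure γ - γ a`, which bounds the number of cubes needed to cover the set
(`RCM.dimH_E_le_pressure`). Conversely, independent labels with law `p ∈ 𝕊_a` define a measure on
branches under which, by the strong law of large numbers, the frequencies tend to `p` and the masses
of the cubes decay at the rate `H(p)`; the mass distribution principle then gives dimension at least
`H(p)` (`RCM.entropy_le_dimH_E`). This measure could charge the boundaries of the cubes, where the
coding may be undefined. Therefore the digits in the square generations are prescribed, all `0` and
all `1` in turn: no coordinate is then dyadic, and the squares have density zero, so that no mean
value changes.

*Dissipation.* Let `q j` be the quotient of `u j / u (father j)` by its value for the explicit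
solution `β √(d j)`. The stationary equation says that the mean of `q` over the offspring of `j`,
with weights `gibbs (3 / 2)`, is `q j ^ (-2)`. A value `q j ≠ 1` would then spread to descendants
with doubly exponential growth, against `u ∈ H^s` (`RCM.IsConstantSolution.defect_eq_one`). So
`q = 1`, the dissipation is the product weight of `gibbs (3 / 2)`, and by Chebyshev's inequality it
concentrates where `σ` is near `φ (3 / 2)`.
-/

namespace DyadicTree

/-! ### Words, branches and sums over a generation -/

section Words

variable {d : ℕ}

lemma branch_succ (ξ : ℕ → Digit d) (n : ℕ) : branch ξ (n + 1) = branch ξ n ++ [ξ n] := by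
  rw [branch, List.ofFn_succ', List.concat_eq_append]
  rfl

@[simp] lemma length_branch (ξ : ℕ → Digit d) (n : ℕ) : (branch ξ n).length = n := by
  simp [branch]

lemma sum_generation_succ (n : ℕ) (g : Node d → ℝ) :
    ∑ j : Fin (n + 1) → Digit d, g (List.ofFn j) =
      ∑ j : Fin n → Digit d, ∑ i : Digit d, g (List.ofFn j ++ [i]) := by
  rw [← (Fin.snocEquiv (fun _ : Fin (n + 1) => Digit d)).sum_comp, Fintype.sum_prod_type,
    Finset.sum_comm]
  refine Finset.sum_congr rfl fun j _ => Finset.sum_congr rfl fun i _ => ?_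
  rw [List.ofFn_succ', List.concat_eq_append]
  simp [Fin.snocEquiv]

lemma take_append_singleton {j : Node d} (i : Digit d) {m : ℕ} (hm : m < j.length) :
    (j ++ [i]).take (m + 1) = j.take (m + 1) :=
  List.take_append_of_le_length hm

lemma take_append_singleton_length (j : Node d) (i : Digit d) :
    (j ++ [i]).take (j.length + 1) = j ++ [i] :=
  List.take_of_length_le (by simp)

end Words

namespace RCM

variable {d : ℕ} {Ω : Type*}

/-! ### Additive and multiplicative functions of the labels -/

/-- The sum of `g` over the labels of the ancestors of `j` other than the root. -/
noncomputable def labelSum (M : RCM d Ω) (g : Ω → ℝ) (j : Node d) : ℝ :=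
  ∑ m ∈ Finset.range j.length, g (M.label (j.take (m + 1)))

/-- The mass of the cube of `j` when at each node the mass is split among the offspring in the
proportions `p` of their labels. -/
noncomputable def weight (M : RCM d Ω) (p : Ω → ℝ) (j : Node d) : ℝ :=
  ∏ m ∈ Finset.range j.length, p (M.label (j.take (m + 1)))

@[simp] lemma labelSum_nil (M : RCM d Ω) (g : Ω → ℝ) : M.labelSum g [] = 0 := by simp [labelSum]

@[simp] lemma weight_nil (M : RCM d Ω) (p : Ω → ℝ) : M.weight p [] = 1 := by simp [weight]

lemma labelSum_append (M : RCM d Ω) (g : Ω → ℝ) (j : Node d) (i : Digit d) :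
    M.labelSum g (j ++ [i]) = M.labelSum g j + g (M.label (j ++ [i])) := by
  rw [labelSum, List.length_append, List.length_singleton, Finset.sum_range_succ,
    take_append_singleton_length, labelSum]
  congr 1
  refine Finset.sum_congr rfl fun m hm => ?_
  rw [take_append_singleton i (Finset.mem_range.1 hm)]

lemma weight_append (M : RCM d Ω) (p : Ω → ℝ) (j : Node d) (i : Digit d) :
    M.weight p (j ++ [i]) = M.weight p j * p (M.label (j ++ [i])) := by
  rw [weight, List.length_append, List.length_singleton, Finset.prod_range_succ,
    take_append_singleton_length, weight]
  congr 1
  refine Finset.prod_congr rfl fun m hm => ?_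
  rw [take_append_singleton i (Finset.mem_range.1 hm)]

lemma labelSum_const_mul (M : RCM d Ω) (g : Ω → ℝ) (a : ℝ) (j : Node d) :
    M.labelSum (fun ω => a * g ω) j = a * M.labelSum g j :=
  (Finset.mul_sum _ _ _).symm

/-- Label sums of `log₂ p` are the logarithms of the weights. -/
lemma weight_eq_rpow (M : RCM d Ω) {p : Ω → ℝ} (hp : ∀ ω, 0 < p ω) (j : Node d) :
    M.weight p j = 2 ^ M.labelSum (fun ω => Real.logb 2 (p ω)) j := by
  rw [labelSum, Real.rpow_sum_of_pos (by norm_num)]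
  exact Finset.prod_congr rfl fun m _ =>
    (Real.rpow_logb (by norm_num) (by norm_num) (hp _)).symm

lemma labelSum_sub_const (M : RCM d Ω) (g : Ω → ℝ) (a : ℝ) (j : Node d) :
    M.labelSum (fun ω => g ω - a) j = M.labelSum g j - j.length * a := by
  simp [labelSum, Finset.sum_sub_distrib]

lemma nonempty_label (M : RCM d Ω) : Nonempty Ω := ⟨M.label []⟩

lemma freq_mem_Icc (M : RCM d Ω) (j : Node d) (ω : Ω) : M.freq j ω ∈ Set.Icc (0 : ℝ) 1 := by
  classical
  refine ⟨by unfold freq; positivity, div_le_one_of_le₀ ?_ (by positivity)⟩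
  exact_mod_cast (Finset.card_filter_le _ _).trans (by simp)

lemma coeff_eq (M : RCM d Ω) {j : Node d} (hj : j ≠ []) : M.coeff j = M.δ (M.label j) := by
  have h := M.coeff_append j.dropLast (j.getLast hj)
  rwa [List.dropLast_append_getLast hj] at h

lemma coeff_pos (M : RCM d Ω) (j : Node d) : 0 < M.coeff j := by
  by_cases hj : j = []
  · simp [hj, M.coeff_nil]
  · rw [M.coeff_eq hj]
    exact M.δ_pos _

/-- The root does not contribute to `σ_j`, as its coefficient is `1`. -/
lemma sigmaNode_eq (M : RCM d Ω) (j : Node d) :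
    M.sigmaNode j = M.labelSum (fun ω => Real.logb 2 (M.δ ω)) j / j.length := by
  rw [sigmaNode, Finset.sum_range_succ', List.take_zero, M.coeff_nil, Real.logb_one, add_zero,
    labelSum]
  congr 1
  refine Finset.sum_congr rfl fun m hm => ?_
  rw [M.coeff_eq]
  have := Finset.mem_range.1 hm
  exact List.ne_nil_of_length_pos (by rw [List.length_take]; omega)

variable [Fintype Ω]

lemma sum_label (M : RCM d Ω) (g : Ω → ℝ) (j : Node d) :
    ∑ i : Digit d, g (M.label (j ++ [i])) = ∑ ω, g ω :=
  (M.label_bijective j).sum_comp g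

lemma card_label (M : RCM d Ω) : Fintype.card Ω = 2 ^ d := by
  rw [← Fintype.card_of_bijective (M.label_bijective [])]
  simp

lemma sum_weight (M : RCM d Ω) {p : Ω → ℝ} (hp : ∑ ω, p ω = 1) (n : ℕ) :
    ∑ j : Fin n → Digit d, M.weight p (List.ofFn j) = 1 := by
  induction n with
  | zero => simp
  | succ n ih =>
    simp_rw [sum_generation_succ, weight_append, ← Finset.mul_sum, M.sum_label p, hp, mul_one, ih]

/-- The frequencies of the labels determine all label sums. -/
lemma sum_freq_mul (M : RCM d Ω) (g : Ω → ℝ) (j : Node d) :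
    ∑ ω, M.freq j ω * g ω = M.labelSum g j / j.length := by
  classical
  simp only [freq, labelSum, Finset.card_filter, Nat.cast_sum, Finset.sum_div, Finset.sum_mul]
  rw [Finset.sum_comm]
  refine Finset.sum_congr rfl fun m _ => ?_
  rw [Finset.sum_eq_single (M.label (j.take (m + 1)))]
  · simp; ring
  · intro ω _ hω
    simp [hω.symm]
  · simp

lemma sigma_freq (M : RCM d Ω) (j : Node d) :
    M.sigma (M.freq j) = M.labelSum (fun ω => Real.logb 2 (M.δ ω)) j / j.length :=
  M.sum_freq_mul _ j

/-! ### Moments of label sums -/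

/-- Under `weight p` the labels along a branch are independent with law `p`, so variances add. -/
lemma sum_weight_mul_labelSum_sq (M : RCM d Ω) {p g : Ω → ℝ} (hp : ∑ ω, p ω = 1)
    (hg : ∑ ω, p ω * g ω = 0) (n : ℕ) :
    ∑ j : Fin n → Digit d, M.weight p (List.ofFn j) * M.labelSum g (List.ofFn j) ^ 2 =
      n * ∑ ω, p ω * g ω ^ 2 := by
  induction n with
  | zero => simp
  | succ n ih =>
    rw [sum_generation_succ n (fun j => M.weight p j * M.labelSum g j ^ 2)]
    have key (j : Fin n → Digit d) :
        ∑ i, M.weight p (List.ofFn j ++ [i]) * M.labelSum g (List.ofFn j ++ [i]) ^ 2 =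
        M.weight p (List.ofFn j) * M.labelSum g (List.ofFn j) ^ 2 +
          M.weight p (List.ofFn j) * ∑ ω, p ω * g ω ^ 2 := by
      have := M.sum_label (fun ω => M.weight p (List.ofFn j) * p ω *
        (M.labelSum g (List.ofFn j) + g ω) ^ 2) (List.ofFn j)
      simp only [weight_append, labelSum_append, this]
      have e (ω : Ω) : M.weight p (List.ofFn j) * p ω * (M.labelSum g (List.ofFn j) + g ω) ^ 2 =
        M.weight p (List.ofFn j) * M.labelSum g (List.ofFn j) ^ 2 * p ω +
        2 * M.weight p (List.ofFn j) * M.labelSum g (List.ofFn j) * (p ω * g ω) +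
          M.weight p (List.ofFn j) * (p ω * g ω ^ 2) := by ring
      simp_rw [e, Finset.sum_add_distrib, ← Finset.mul_sum, hp, hg]
      ring
    simp_rw [key, Finset.sum_add_distrib, ih, ← Finset.sum_mul, M.sum_weight hp]
    push_cast
    ring

end RCM

end DyadicTree

namespace DyadicTree

/-! ### Entropy and Gibbs vectors -/

section Entropy

variable {Ω : Type*} [Fintype Ω]

lemma entropy_add_sum_mul_logb (p q : Ω → ℝ) : entropy p + ∑ ω, p ω * Real.logb 2 (q ω) =
    (∑ ω, p ω * (Real.log (q ω) - Real.log (p ω))) / Real.log 2 := by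
  rw [entropy, neg_add_eq_sub, ← Finset.sum_sub_distrib, Finset.sum_div]
  refine Finset.sum_congr rfl fun ω _ => ?_
  simp only [Real.logb]
  ring

lemma mul_log_sub_log_lt {x y : ℝ} (hx : 0 < x) (hy : 0 < y) (h : x ≠ y) :
    x * (Real.log y - Real.log x) < y - x := by
  have h1 := Real.log_lt_sub_one_of_pos (div_pos hy hx)
    fun e => h ((div_eq_one_iff_eq hx.ne').1 e).symm
  rw [Real.log_div hy.ne' hx.ne'] at h1
  calc x * (Real.log y - Real.log x) < x * (y / x - 1) := mul_lt_mul_of_pos_left h1 hx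
    _ = y - x := by field_simp

lemma mul_log_sub_log_le {x y : ℝ} (hx : 0 ≤ x) (hy : 0 < y) :
    x * (Real.log y - Real.log x) ≤ y - x := by
  rcases hx.eq_or_lt with rfl | hx
  · simp [hy.le]
  by_cases h : x = y
  · simp [h]
  · exact (mul_log_sub_log_lt hx hy h).le

/-- Gibbs' inequality. -/
lemma entropy_le_neg_sum {p q : Ω → ℝ} (hp : ∀ ω, 0 ≤ p ω) (hq : ∀ ω, 0 < q ω)
    (hpq : ∑ ω, p ω = ∑ ω, q ω) : entropy p ≤ -∑ ω, p ω * Real.logb 2 (q ω) := by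
  rw [le_neg_iff_add_nonpos_right, entropy_add_sum_mul_logb]
  refine div_nonpos_of_nonpos_of_nonneg ?_ (Real.log_nonneg (by norm_num))
  refine (Finset.sum_le_sum fun ω _ => mul_log_sub_log_le (hp ω) (hq ω)).trans ?_
  rw [Finset.sum_sub_distrib, hpq, sub_self]

/-- The case of equality in Gibbs' inequality. -/
lemma eq_of_entropy_eq {p q : Ω → ℝ} (hp : ∀ ω, 0 < p ω) (hq : ∀ ω, 0 < q ω)
    (hpq : ∑ ω, p ω = ∑ ω, q ω) (h : -∑ ω, p ω * Real.logb 2 (q ω) ≤ entropy p) : p = q := by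
  by_contra hne
  obtain ⟨ω, hω⟩ := Function.ne_iff.1 hne
  rw [neg_le_iff_add_nonneg, entropy_add_sum_mul_logb] at h
  refine absurd h (not_le.2 (div_neg_of_neg_of_pos ?_ (Real.log_pos (by norm_num))))
  refine (Finset.sum_lt_sum (fun ω _ => mul_log_sub_log_le (hp ω).le (hq ω))
    ⟨ω, Finset.mem_univ ω, mul_log_sub_log_lt (hp ω) (hq ω) hω⟩).trans_eq ?_
  rw [Finset.sum_sub_distrib, hpq, sub_self]

lemma entropy_nonneg {p : Ω → ℝ} (hp : p ∈ stdSimplex ℝ Ω) : 0 ≤ entropy p := by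
  rw [entropy, neg_nonneg]
  refine Finset.sum_nonpos fun ω _ => mul_nonpos_of_nonneg_of_nonpos (hp.1 ω) ?_
  refine Real.logb_nonpos (by norm_num) (hp.1 ω) ?_
  exact hp.2 ▸ Finset.single_le_sum (fun i _ => hp.1 i) (Finset.mem_univ ω)

end Entropy

namespace RCM

variable {d : ℕ} {Ω : Type*} [Fintype Ω]

/-- The partition function of the logarithms of the coefficients. -/
noncomputable def partition (M : RCM d Ω) (γ : ℝ) : ℝ := ∑ ω, M.δ ω ^ γ

/-- The binary logarithm of the partition function. -/
noncomputable def pressure (M : RCM d Ω) (γ : ℝ) : ℝ := Real.logb 2 (M.partition γ)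

/-- The probability vector proportional to `δ ^ γ`. -/
noncomputable def gibbs (M : RCM d Ω) (γ : ℝ) (ω : Ω) : ℝ := M.δ ω ^ γ / M.partition γ

lemma partition_pos (M : RCM d Ω) (γ : ℝ) : 0 < M.partition γ := by
  have := M.nonempty_label
  exact Finset.sum_pos (fun ω _ => Real.rpow_pos_of_pos (M.δ_pos ω) γ) Finset.univ_nonempty

lemma gibbs_pos (M : RCM d Ω) (γ : ℝ) (ω : Ω) : 0 < M.gibbs γ ω :=
  div_pos (Real.rpow_pos_of_pos (M.δ_pos ω) γ) (M.partition_pos γ)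

lemma sum_gibbs (M : RCM d Ω) (γ : ℝ) : ∑ ω, M.gibbs γ ω = 1 := by
  simp_rw [gibbs, ← Finset.sum_div]
  exact div_self (M.partition_pos γ).ne'

lemma logb_gibbs (M : RCM d Ω) (γ : ℝ) (ω : Ω) :
    Real.logb 2 (M.gibbs γ ω) = γ * Real.logb 2 (M.δ ω) - M.pressure γ := by
  rw [gibbs, Real.logb_div (Real.rpow_pos_of_pos (M.δ_pos ω) γ).ne' (M.partition_pos γ).ne',
    Real.logb_rpow_eq_mul_logb_of_pos (M.δ_pos ω), pressure]

lemma gibbs_mem_level (M : RCM d Ω) (γ : ℝ) : M.gibbs γ ∈ M.level (M.phi γ) :=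
  ⟨⟨fun ω => (M.gibbs_pos γ ω).le, M.sum_gibbs γ⟩, rfl⟩

lemma neg_sum_mul_logb_gibbs (M : RCM d Ω) (γ : ℝ) {a : ℝ} {p : Ω → ℝ} (hp : p ∈ M.level a) :
    -∑ ω, p ω * Real.logb 2 (M.gibbs γ ω) = M.pressure γ - γ * a := by
  have e (ω : Ω) : p ω * (γ * Real.logb 2 (M.δ ω) - M.pressure γ) =
    γ * (p ω * Real.logb 2 (M.δ ω)) - p ω * M.pressure γ := by ring
  have h : ∑ ω, p ω * Real.logb 2 (M.δ ω) = a := hp.2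
  simp_rw [logb_gibbs, e, Finset.sum_sub_distrib, ← Finset.mul_sum, ← Finset.sum_mul, h, hp.1.2]
  ring

lemma entropy_le_pressure (M : RCM d Ω) (γ : ℝ) {a : ℝ} {p : Ω → ℝ} (hp : p ∈ M.level a) :
    entropy p ≤ M.pressure γ - γ * a := by
  rw [← M.neg_sum_mul_logb_gibbs γ hp]
  exact entropy_le_neg_sum hp.1.1 (M.gibbs_pos γ) (hp.1.2.trans (M.sum_gibbs γ).symm)

lemma entropy_gibbs (M : RCM d Ω) (γ : ℝ) :
    entropy (M.gibbs γ) = M.pressure γ - γ * M.phi γ :=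
  M.neg_sum_mul_logb_gibbs γ (M.gibbs_mem_level γ)

lemma flat_of_gibbs_eq (M : RCM d Ω) {γ γ' : ℝ} (h : M.gibbs γ = M.gibbs γ') (hne : γ ≠ γ') :
    M.Flat := by
  intro ω ω'
  have h1 := congrArg (Real.logb 2) (congrFun h ω)
  have h2 := congrArg (Real.logb 2) (congrFun h ω')
  rw [logb_gibbs, logb_gibbs] at h1 h2
  refine Real.logb_injOn_pos (b := 2) (by norm_num) (M.δ_pos ω) (M.δ_pos ω') ?_
  have : (γ - γ') * (Real.logb 2 (M.δ ω) - Real.logb 2 (M.δ ω')) = 0 := by linarith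
  rcases mul_eq_zero.1 this with h0 | h0
  · exact absurd (sub_eq_zero.1 h0) hne
  · exact sub_eq_zero.1 h0

lemma phi_injective (M : RCM d Ω) (hM : ¬ M.Flat) : Function.Injective M.phi := by
  intro γ γ' h
  by_contra hne
  refine hM (M.flat_of_gibbs_eq ?_ hne)
  -- The two vectors lie on the same level, so each of them maximises the entropy there.
  have hl : M.gibbs γ' ∈ M.level (M.phi γ) := h ▸ M.gibbs_mem_level γ'
  have h1 := M.entropy_le_pressure γ' (h ▸ M.gibbs_mem_level γ : M.gibbs γ ∈ M.level (M.phi γ'))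
  refine (eq_of_entropy_eq (M.gibbs_pos γ') (M.gibbs_pos γ)
    ((M.sum_gibbs γ').trans (M.sum_gibbs γ).symm) ?_).symm
  rw [M.neg_sum_mul_logb_gibbs γ hl, ← M.entropy_gibbs, M.entropy_gibbs γ']
  exact h1

lemma partition_zero (M : RCM d Ω) : M.partition 0 = 2 ^ d := by
  simp [partition, M.card_label]

lemma pressure_zero (M : RCM d Ω) : M.pressure 0 = d := by
  rw [pressure, partition_zero, Real.logb_pow]; simp

lemma mul_ell (M : RCM d Ω) (γ : ℝ) : γ * M.ell γ = M.pressure γ - d := by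
  by_cases h : γ = 0
  · simp [h, pressure_zero]
  · rw [ell, if_neg h, ← mul_assoc, mul_one_div_cancel h, one_mul, ← partition,
      Real.logb_div (M.partition_pos γ).ne' (by positivity), Real.logb_pow]
    simp [pressure]

lemma entropy_gibbs_lt (M : RCM d Ω) (hM : ¬ M.Flat) {γ : ℝ} (hγ : γ ≠ 0) :
    entropy (M.gibbs γ) < d := by
  by_contra! h
  refine hM (M.flat_of_gibbs_eq (eq_of_entropy_eq (M.gibbs_pos γ) (M.gibbs_pos 0)
    ((M.sum_gibbs γ).trans (M.sum_gibbs 0).symm) ?_) hγ)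
  rw [M.neg_sum_mul_logb_gibbs 0 (M.gibbs_mem_level γ), pressure_zero]
  simpa using h

lemma logb_delta_mem (M : RCM d Ω) (ω : Ω) :
    Real.logb 2 (M.δ ω) ∈ Set.Icc M.ellBot M.ellTop :=
  ⟨ciInf_le (Set.finite_range fun ω => Real.logb 2 (M.δ ω)).bddBelow ω,
    le_ciSup (Set.finite_range fun ω => Real.logb 2 (M.δ ω)).bddAbove ω⟩

lemma sigma_mem (M : RCM d Ω) {p : Ω → ℝ} (hp : p ∈ stdSimplex ℝ Ω) :
    M.sigma p ∈ Set.Icc M.ellBot M.ellTop := by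
  constructor
  · calc M.ellBot = ∑ ω, p ω * M.ellBot := by rw [← Finset.sum_mul, hp.2, one_mul]
      _ ≤ _ := Finset.sum_le_sum fun ω _ =>
        mul_le_mul_of_nonneg_left (M.logb_delta_mem ω).1 (hp.1 ω)
  · calc M.sigma p ≤ ∑ ω, p ω * M.ellTop := Finset.sum_le_sum fun ω _ =>
        mul_le_mul_of_nonneg_left (M.logb_delta_mem ω).2 (hp.1 ω)
      _ = M.ellTop := by rw [← Finset.sum_mul, hp.2, one_mul]

lemma phi_mem (M : RCM d Ω) (γ : ℝ) : M.phi γ ∈ Set.Icc M.ellBot M.ellTop :=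
  M.sigma_mem (M.gibbs_mem_level γ).1

/-- The pressure is differentiable with derivative `φ`. -/
lemma hasDerivAt_pressure (M : RCM d Ω) (γ : ℝ) : HasDerivAt M.pressure (M.phi γ) γ := by
  have h1 : HasDerivAt M.partition (∑ ω, M.δ ω ^ γ * Real.log (M.δ ω)) γ := by
    refine (HasDerivAt.fun_sum (u := Finset.univ) fun ω _ =>
      (hasDerivAt_id' γ).const_rpow (a := M.δ ω) (M.δ_pos ω)).congr_deriv ?_
    refine Finset.sum_congr rfl fun ω _ => ?_
    ring
  refine ((h1.log (M.partition_pos γ).ne').div_const (Real.log 2)).congr_deriv ?_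
  rw [phi, Finset.sum_div, Finset.sum_div]
  refine Finset.sum_congr rfl fun ω _ => ?_
  simp only [partition, Real.logb]
  ring

/-- A single term of the partition function bounds the pressure from below. -/
lemma mul_logb_le_pressure (M : RCM d Ω) (γ : ℝ) (ω : Ω) :
    γ * Real.logb 2 (M.δ ω) ≤ M.pressure γ := by
  rw [← Real.logb_rpow_eq_mul_logb_of_pos (M.δ_pos ω)]
  refine Real.logb_le_logb_of_le (by norm_num) (Real.rpow_pos_of_pos (M.δ_pos ω) γ) ?_
  exact Finset.single_le_sum (f := fun v => M.δ v ^ γ)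
    (fun v _ => (Real.rpow_pos_of_pos (M.δ_pos v) γ).le) (Finset.mem_univ ω)

/-- Strictly between the extreme values of `log₂ δ`, the function `pressure γ - γ a` is coercive;
`φ` takes the value `a` where it is minimal. -/
lemma exists_phi_eq (M : RCM d Ω) {a : ℝ} (ha : a ∈ Set.Ioo M.ellBot M.ellTop) :
    ∃ γ, M.phi γ = a := by
  have := M.nonempty_label
  obtain ⟨ω₀, h₀⟩ := exists_eq_ciInf_of_finite (f := fun ω => Real.logb 2 (M.δ ω))
  obtain ⟨ω₁, h₁⟩ := exists_eq_ciSup_of_finite (f := fun ω => Real.logb 2 (M.δ ω))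
  have hd (γ : ℝ) : HasDerivAt (fun γ => M.pressure γ - γ * a) (M.phi γ - a) γ := by
    simpa using (M.hasDerivAt_pressure γ).fun_sub ((hasDerivAt_id' γ).mul_const a)
  have hc : Continuous fun γ => M.pressure γ - γ * a :=
    continuous_iff_continuousAt.2 fun γ => (hd γ).continuousAt
  have hlim : Tendsto (fun γ => M.pressure γ - γ * a) (cocompact ℝ) atTop := by
    rw [cocompact_eq_atBot_atTop, tendsto_sup]
    constructor
    · have h : M.ellBot - a < 0 := sub_neg.2 ha.1
      refine tendsto_atTop_mono (fun γ => ?_) (tendsto_id.atBot_mul_const_of_neg h)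
      have := M.mul_logb_le_pressure γ ω₀
      rw [show Real.logb 2 (M.δ ω₀) = M.ellBot from h₀] at this
      simp only [id]
      linarith
    · have h : 0 < M.ellTop - a := sub_pos.2 ha.2
      refine tendsto_atTop_mono (fun γ => ?_) (tendsto_id.atTop_mul_const h)
      have := M.mul_logb_le_pressure γ ω₁
      rw [show Real.logb 2 (M.δ ω₁) = M.ellTop from h₁] at this
      simp only [id]
      linarith
  obtain ⟨γ, hγ⟩ := hc.exists_forall_le hlim
  have hmin : IsLocalMin (fun γ => M.pressure γ - γ * a) γ := Eventually.of_forall hγ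
  exact ⟨γ, sub_eq_zero.1 (hmin.hasDerivAt_eq_zero (hd γ))⟩

/-- At an extreme value `a` of `log₂ δ` the uniform vector on the labels with that value is the
limit of the Gibbs vectors as `s * γ → ∞`. -/
lemma exists_level_extreme (M : RCM d Ω) {a s : ℝ} (ω₀ : Ω) (h₀ : Real.logb 2 (M.δ ω₀) = a)
    (hs : ∀ ω, s * (Real.logb 2 (M.δ ω) - a) ≤ 0) (hs0 : s ≠ 0) :
    ∃ p ∈ M.level a, ∀ ε > 0, ∃ γ, M.pressure γ - γ * a < entropy p + ε := by
  classical
  set A : Finset Ω := Finset.univ.filter fun ω => Real.logb 2 (M.δ ω) = a with hA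
  have hcard : (0 : ℝ) < A.card := by
    exact_mod_cast Finset.card_pos.2 ⟨ω₀, by simp [hA, h₀]⟩
  refine ⟨fun ω => if ω ∈ A then (A.card : ℝ)⁻¹ else 0, ⟨⟨fun ω => ?_, ?_⟩, ?_⟩, fun ε hε => ?_⟩
  · dsimp only
    split_ifs <;> positivity
  · simp [hcard.ne']
  · have e (ω : Ω) : (if ω ∈ A then (A.card : ℝ)⁻¹ else 0) * Real.logb 2 (M.δ ω) =
        if ω ∈ A then (A.card : ℝ)⁻¹ * a else 0 := by
      split_ifs with h
      · rw [(Finset.mem_filter.1 h).2]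
      · simp
    simp only [sigma, e, Finset.sum_ite_mem, Finset.univ_inter, Finset.sum_const, nsmul_eq_mul]
    field_simp
  · have hent : entropy (fun ω => if ω ∈ A then (A.card : ℝ)⁻¹ else 0) = Real.logb 2 A.card := by
      have e (ω : Ω) : (if ω ∈ A then (A.card : ℝ)⁻¹ else 0) *
          Real.logb 2 (if ω ∈ A then (A.card : ℝ)⁻¹ else 0) =
          if ω ∈ A then (A.card : ℝ)⁻¹ * -Real.logb 2 A.card else 0 := by
        split_ifs with h
        · rw [Real.logb_inv]
        · simp
      simp only [entropy, e, Finset.sum_ite_mem, Finset.univ_inter, Finset.sum_const, nsmul_eq_mul]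
      field_simp
    -- Away from `A` the terms of `∑ (δ 2 ^ (-a)) ^ γ` tend to `0`; on `A` they are equal to `1`.
    have hterm (ω : Ω) : Tendsto (fun t : ℝ => (2 : ℝ) ^ (t * (s * (Real.logb 2 (M.δ ω) - a))))
        atTop (𝓝 (if ω ∈ A then 1 else 0)) := by
      split_ifs with h
      · simp [(Finset.mem_filter.1 h).2]
      · have hlt : s * (Real.logb 2 (M.δ ω) - a) < 0 := by
          refine lt_of_le_of_ne (hs ω) (mul_ne_zero hs0 (sub_ne_zero.2 ?_))
          simpa [hA] using h
        exact (tendsto_rpow_atBot_of_base_gt_one 2 (by norm_num)).comp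
          (tendsto_id.atTop_mul_const_of_neg hlt)
    have hsum : Tendsto (fun t : ℝ => ∑ ω, (2 : ℝ) ^ (t * (s * (Real.logb 2 (M.δ ω) - a))))
        atTop (𝓝 A.card) := by
      have := tendsto_finsetSum Finset.univ fun ω _ => hterm ω
      simpa using this
    have hlog := hsum.logb (b := 2) hcard.ne'
    obtain ⟨t, ht⟩ := (hlog.eventually (gt_mem_nhds (lt_add_of_pos_right _ hε))).exists
    refine ⟨s * t, ?_⟩
    rw [hent]
    refine lt_of_eq_of_lt ?_ ht
    have e (ω : Ω) : (2 : ℝ) ^ (t * (s * (Real.logb 2 (M.δ ω) - a))) =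
        M.δ ω ^ (s * t) * 2 ^ (-(s * t * a)) := by
      have hb : (2 : ℝ) ^ (Real.logb 2 (M.δ ω)) = M.δ ω :=
        Real.rpow_logb (by norm_num) (by norm_num) (M.δ_pos ω)
      nth_rw 2 [← hb]
      rw [← Real.rpow_mul (by norm_num), ← Real.rpow_add (by norm_num)]
      ring_nf
    simp_rw [e, ← Finset.sum_mul]
    rw [← partition, Real.logb_mul (M.partition_pos _).ne'
      (Real.rpow_pos_of_pos (by norm_num) _).ne', Real.logb_rpow (by norm_num) (by norm_num)]
    simp [pressure, sub_eq_add_neg]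

/-- On every level the entropy of some vector attains the infimum of the Gibbs bounds. -/
lemma exists_entropy_eq (M : RCM d Ω) {a : ℝ} (ha : a ∈ Set.Icc M.ellBot M.ellTop) :
    ∃ p ∈ M.level a, ∀ ε > 0, ∃ γ, M.pressure γ - γ * a < entropy p + ε := by
  have := M.nonempty_label
  rcases ha.1.eq_or_lt with h | h
  · obtain ⟨ω, hω⟩ := exists_eq_ciInf_of_finite (f := fun ω => Real.logb 2 (M.δ ω))
    refine M.exists_level_extreme (s := -1) ω (hω.trans h) (fun ω => ?_) (by norm_num)
    have := (M.logb_delta_mem ω).1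
    linarith
  rcases ha.2.eq_or_lt with h' | h'
  · obtain ⟨ω, hω⟩ := exists_eq_ciSup_of_finite (f := fun ω => Real.logb 2 (M.δ ω))
    refine M.exists_level_extreme (s := 1) ω (hω.trans h'.symm) (fun ω => ?_) (by norm_num)
    have := (M.logb_delta_mem ω).2
    linarith
  · obtain ⟨γ, rfl⟩ := M.exists_phi_eq ⟨h, h'⟩
    exact ⟨_, M.gibbs_mem_level γ, fun ε hε => ⟨γ, by rw [M.entropy_gibbs]; linarith⟩⟩

lemma isGreatest_entropy (M : RCM d Ω) {a : ℝ} {p : Ω → ℝ} (hp : p ∈ M.level a)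
    (h : ∀ ε > 0, ∃ γ, M.pressure γ - γ * a < entropy p + ε) :
    IsGreatest (entropy '' M.level a) (entropy p) := by
  refine ⟨⟨p, hp, rfl⟩, ?_⟩
  rintro _ ⟨q, hq, rfl⟩
  refine le_of_forall_pos_le_add fun ε hε => ?_
  obtain ⟨γ, hγ⟩ := h ε hε
  exact (M.entropy_le_pressure γ hq).trans hγ.le

lemma D_phi (M : RCM d Ω) (γ : ℝ) : M.D (M.phi γ) = M.pressure γ - γ * M.phi γ := by
  rw [← entropy_gibbs]
  exact (M.isGreatest_entropy (M.gibbs_mem_level γ)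
    fun ε hε => ⟨γ, by rw [M.entropy_gibbs]; linarith⟩).csSup_eq

end RCM

end DyadicTree

namespace DyadicTree

/-! ### Geometry of the dyadic cubes -/

variable {d : ℕ}

/-- The corner of the cube of `j` along the axis `c`, in units of the side of the cube. -/
def position (j : Node d) (c : Fin d) : ℕ := j.foldl (fun k i => 2 * k + i c) 0

lemma position_append (j : Node d) (i : Digit d) (c : Fin d) :
    position (j ++ [i]) c = 2 * position j c + i c := by
  simp [position]

lemma corner_append (j : Node d) (i : Digit d) (c : Fin d) :
    corner (j ++ [i]) c = corner j c + ((i c : ℕ) : ℝ) / 2 ^ (j.length + 1) := by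
  have key (j : Node d) : corner j c = ∑ m ∈ Finset.range j.length,
      ((j[m]?.elim 0 fun i => (i c : ℕ) : ℕ) : ℝ) / 2 ^ (m + 1) := by
    rw [Finset.sum_range, corner]
    simp
  rw [key, key, List.length_append, List.length_singleton, Finset.sum_range_succ]
  congr 1
  · refine Finset.sum_congr rfl fun m hm => ?_
    rw [List.getElem?_append_left (Finset.mem_range.1 hm)]
  · simp

lemma corner_eq (j : Node d) (c : Fin d) : corner j c = position j c / 2 ^ j.length := by
  induction j using List.reverseRecOn with
  | nil => simp [corner, position]
  | append_singleton j i ih =>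
    rw [corner_append, ih, position_append, List.length_append, List.length_singleton]
    push_cast
    field_simp
    ring

lemma eq_of_position_eq {j j' : Node d} (hl : j.length = j'.length)
    (h : ∀ c, position j c = position j' c) : j = j' := by
  induction j using List.reverseRecOn generalizing j' with
  | nil => exact (List.length_eq_zero_iff.1 hl.symm).symm
  | append_singleton j i ih =>
    rcases List.eq_nil_or_concat' j' with rfl | ⟨k, i', rfl⟩
    · simp at hl
    simp only [position_append] at h
    have hi : i = i' := by
      ext c
      have := h c
      omega
    have hk : j = k := ih (by simpa using hl) fun c => by
      have := h c
      have := (i c).2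
      have := (i' c).2
      omega
    rw [hi, hk]

lemma mem_cube_iff {j : Node d} {x : EuclideanSpace ℝ (Fin d)} : x ∈ cube j ↔
    ∀ c, (position j c : ℝ) ≤ 2 ^ j.length * x c ∧ 2 ^ j.length * x c ≤ position j c + 1 := by
  refine forall_congr' fun c => ?_
  have h : (0 : ℝ) < 2 ^ j.length := by positivity
  rw [corner_eq, ← add_div, div_le_iff₀' h, le_div_iff₀' h]

lemma dist_le_of_forall_abs_le {x y : EuclideanSpace ℝ (Fin d)} {r : ℝ} (hr : 0 ≤ r)
    (h : ∀ c, |x c - y c| ≤ r) : dist x y ≤ √d * r := by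
  rw [EuclideanSpace.dist_eq]
  refine Real.sqrt_le_iff.2 ⟨by positivity, ?_⟩
  calc ∑ c, dist (x c) (y c) ^ 2 ≤ ∑ _c : Fin d, r ^ 2 :=
        Finset.sum_le_sum fun c _ => pow_le_pow_left₀ dist_nonneg (h c) 2
    _ = (√d * r) ^ 2 := by simp [mul_pow]

lemma abs_sub_le_dist (x y : EuclideanSpace ℝ (Fin d)) (c : Fin d) : |x c - y c| ≤ dist x y := by
  rw [dist_eq_norm]
  exact PiLp.norm_apply_le (x - y) c

lemma ediam_cube_le (j : Node d) :
    Metric.ediam (cube j) ≤ ENNReal.ofReal (√d * (1 / 2 ^ j.length)) := by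
  refine Metric.ediam_le fun x hx y hy => ?_
  rw [edist_dist]
  refine ENNReal.ofReal_le_ofReal (dist_le_of_forall_abs_le (by positivity) fun c => ?_)
  have h1 := hx c
  have h2 := hy c
  rw [abs_le]
  constructor <;> linarith

/-- A set of diameter at most `2 ^ (-n)` meets at most `4 ^ d` cubes of generation `n`. -/
lemma card_cubes_meeting_le (n : ℕ) (s : Set (EuclideanSpace ℝ (Fin d)))
    (hs : ∀ x ∈ s, ∀ y ∈ s, dist x y ≤ 1 / 2 ^ n) (J : Finset (Fin n → Digit d))
    (hJ : ∀ j ∈ J, (cube (List.ofFn j) ∩ s).Nonempty) : J.card ≤ 4 ^ d := by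
  classical
  rcases J.eq_empty_or_nonempty with rfl | ⟨j₀, hj₀⟩
  · simp
  obtain ⟨y, -, hy⟩ := hJ j₀ hj₀
  set B : Finset (Fin d → ℤ) :=
    Fintype.piFinset fun c => Finset.Icc (⌊2 ^ n * y c⌋ - 2) (⌊2 ^ n * y c⌋ + 1) with hB
  have hcard : B.card = 4 ^ d := by
    rw [hB, Fintype.card_piFinset]
    simp [show ∀ a : ℤ, a + 1 + 1 - (a - 2) = 4 by intro a; ring]
  rw [← hcard]
  refine Finset.card_le_card_of_injOn (fun j c => (position (List.ofFn j) c : ℤ)) ?_ ?_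
  · intro j hj
    obtain ⟨x, hx, hxs⟩ := hJ j hj
    simp only [hB, Finset.mem_coe, Fintype.mem_piFinset, Finset.mem_Icc]
    intro c
    obtain ⟨h1, h2⟩ := mem_cube_iff.1 hx c
    rw [List.length_ofFn] at h1 h2
    have hxy := abs_le.1 ((abs_sub_le_dist x y c).trans (hs x hxs y hy))
    have hp : (0 : ℝ) < 2 ^ n := by positivity
    have h3 : -1 ≤ 2 ^ n * x c - 2 ^ n * y c ∧ 2 ^ n * x c - 2 ^ n * y c ≤ 1 := by
      rw [← mul_sub]
      constructor
      · calc (-1 : ℝ) = 2 ^ n * -(1 / 2 ^ n) := by field_simp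
          _ ≤ _ := mul_le_mul_of_nonneg_left hxy.1 hp.le
      · calc 2 ^ n * (x c - y c) ≤ 2 ^ n * (1 / 2 ^ n) := mul_le_mul_of_nonneg_left hxy.2 hp.le
          _ = 1 := by field_simp
    have h4 := Int.floor_le (2 ^ n * y c)
    have h5 := Int.lt_floor_add_one (2 ^ n * y c)
    constructor
    · rw [← @Int.cast_le ℝ]
      push_cast
      linarith
    · rw [← Int.lt_add_one_iff, ← @Int.cast_lt ℝ]
      push_cast
      linarith
  · intro j _ j' _ h
    refine List.ofFn_injective (eq_of_position_eq (by simp) fun c => ?_)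
    exact Int.natCast_inj.1 (congrFun h c)

/-! ### Points that lie on no boundary -/

/-- No coordinate of `x` is a dyadic number. -/
def Generic (x : EuclideanSpace ℝ (Fin d)) : Prop := ∀ c, ∀ n k : ℕ, (2 : ℝ) ^ n * x c ≠ k

lemma Generic.ne_add_one {x : EuclideanSpace ℝ (Fin d)} (hx : Generic x) (c : Fin d) (n k : ℕ) :
    (2 : ℝ) ^ n * x c ≠ k + 1 := by
  simpa using hx c n (k + 1)

lemma Generic.notMem_frontier {x : EuclideanSpace ℝ (Fin d)} (hx : Generic x) (j : Node d) :
    x ∉ frontier (cube j) := by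
  intro h
  have hclosed : IsClosed (cube j) := by
    simp only [cube, Set.ofPred_forall, Set.ofPred_and]
    refine isClosed_iInter fun c => IsClosed.inter ?_ ?_
    · exact isClosed_le (by fun_prop) (by fun_prop)
    · exact isClosed_le (by fun_prop) (by fun_prop)
  rw [hclosed.frontier_eq] at h
  refine h.2 (mem_interior.2 ⟨{x | ∀ c, corner j c < x c ∧ x c < corner j c + 1 / 2 ^ j.length},
    fun y hy c => ⟨(hy c).1.le, (hy c).2.le⟩, ?_, fun c => ?_⟩)
  · simp only [Set.ofPred_forall, Set.ofPred_and]
    refine isOpen_iInter_of_finite fun c => IsOpen.inter ?_ ?_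
    · exact isOpen_lt (by fun_prop) (by fun_prop)
    · exact isOpen_lt (by fun_prop) (by fun_prop)
  · have hp : (0 : ℝ) < 2 ^ j.length := by positivity
    obtain ⟨h1, h2⟩ := mem_cube_iff.1 h.1 c
    rw [corner_eq, ← add_div, div_lt_iff₀' hp, lt_div_iff₀' hp]
    refine ⟨lt_of_le_of_ne h1 (hx c _ _).symm, lt_of_le_of_ne h2 (hx.ne_add_one c _ _)⟩

lemma Generic.eq_of_mem_cube {x : EuclideanSpace ℝ (Fin d)} (hx : Generic x) {j j' : Node d}
    (hl : j.length = j'.length) (h : x ∈ cube j) (h' : x ∈ cube j') : j = j' := by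
  refine eq_of_position_eq hl fun c => ?_
  obtain ⟨h1, h2⟩ := mem_cube_iff.1 h c
  obtain ⟨h3, h4⟩ := mem_cube_iff.1 h' c
  rw [← hl] at h3 h4
  have h2' := lt_of_le_of_ne h2 (hx.ne_add_one c _ _)
  have h4' := lt_of_le_of_ne h4 (hx.ne_add_one c _ _)
  have e1 : position j c < position j' c + 1 := by
    rw [← @Nat.cast_lt ℝ]
    push_cast
    exact h1.trans_lt h4'
  have e2 : position j' c < position j c + 1 := by
    rw [← @Nat.cast_lt ℝ]
    push_cast
    exact h3.trans_lt h2'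
  omega

/-- The point with binary digits `ξ`, the supremum of the corners of its cubes. -/
noncomputable def point (ξ : ℕ → Digit d) : EuclideanSpace ℝ (Fin d) :=
  WithLp.toLp 2 fun c => ⨆ n, corner (branch ξ n) c

lemma corner_branch_succ (ξ : ℕ → Digit d) (n : ℕ) (c : Fin d) :
    corner (branch ξ (n + 1)) c = corner (branch ξ n) c + ((ξ n c : ℕ) : ℝ) / 2 ^ (n + 1) := by
  rw [branch_succ, corner_append, length_branch]

lemma monotone_corner_branch (ξ : ℕ → Digit d) (c : Fin d) :
    Monotone fun n => corner (branch ξ n) c :=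
  monotone_nat_of_le_succ fun n => by
    rw [corner_branch_succ]
    exact le_add_of_nonneg_right (by positivity)

lemma antitone_upper_branch (ξ : ℕ → Digit d) (c : Fin d) :
    Antitone fun n => corner (branch ξ n) c + 1 / 2 ^ n :=
  antitone_nat_of_succ_le fun n => by
    have h : ((ξ n c : ℕ) : ℝ) ≤ 1 := by exact_mod_cast Nat.le_of_lt_succ (ξ n c).2
    have h2 : ((ξ n c : ℕ) : ℝ) / 2 ^ (n + 1) ≤ 1 / 2 ^ (n + 1) := by gcongr
    have h3 : (1 : ℝ) / 2 ^ n = 1 / 2 ^ (n + 1) + 1 / 2 ^ (n + 1) := by field_simp; ring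
    rw [corner_branch_succ]
    linarith

lemma corner_branch_le_upper (ξ : ℕ → Digit d) (c : Fin d) (m n : ℕ) :
    corner (branch ξ m) c ≤ corner (branch ξ n) c + 1 / 2 ^ n :=
  calc corner (branch ξ m) c ≤ corner (branch ξ (max m n)) c :=
        monotone_corner_branch ξ c (le_max_left m n)
    _ ≤ corner (branch ξ (max m n)) c + 1 / 2 ^ max m n := le_add_of_nonneg_right (by positivity)
    _ ≤ _ := antitone_upper_branch ξ c (le_max_right m n)

lemma bddAbove_corner_branch (ξ : ℕ → Digit d) (c : Fin d) :
    BddAbove (Set.range fun n => corner (branch ξ n) c) := by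
  refine ⟨corner (branch ξ 0) c + 1 / 2 ^ 0, ?_⟩
  rintro _ ⟨m, rfl⟩
  exact corner_branch_le_upper ξ c m 0

lemma corner_branch_le_point (ξ : ℕ → Digit d) (c : Fin d) (n : ℕ) :
    corner (branch ξ n) c ≤ point ξ c :=
  le_ciSup (bddAbove_corner_branch ξ c) n

lemma point_le_upper (ξ : ℕ → Digit d) (c : Fin d) (n : ℕ) :
    point ξ c ≤ corner (branch ξ n) c + 1 / 2 ^ n :=
  ciSup_le fun m => corner_branch_le_upper ξ c m n

lemma point_mem_cube (ξ : ℕ → Digit d) (n : ℕ) : point ξ ∈ cube (branch ξ n) := fun c => by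
  rw [length_branch]
  exact ⟨corner_branch_le_point ξ c n, point_le_upper ξ c n⟩

lemma tendsto_corner_branch (ξ : ℕ → Digit d) (c : Fin d) :
    Tendsto (fun n => corner (branch ξ n) c) atTop (𝓝 (point ξ c)) :=
  tendsto_atTop_ciSup (monotone_corner_branch ξ c) (bddAbove_corner_branch ξ c)

/-- If both digits occur infinitely often along every axis then no coordinate is dyadic. -/
lemma generic_point {ξ : ℕ → Digit d} (h0 : ∀ c n, ∃ m ≥ n, ξ m c = 0)
    (h1 : ∀ c n, ∃ m ≥ n, ξ m c = 1) : Generic (point ξ) := by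
  intro c n k hk
  have hp : (0 : ℝ) < 2 ^ n := by positivity
  have hlt : corner (branch ξ n) c < point ξ c := by
    obtain ⟨m, hm, hξ⟩ := h1 c n
    refine ((monotone_corner_branch ξ c hm).trans_lt ?_).trans_le
      (corner_branch_le_point ξ c (m + 1))
    rw [corner_branch_succ, hξ]
    exact lt_add_of_pos_right _ (by simp)
  have hgt : point ξ c < corner (branch ξ n) c + 1 / 2 ^ n := by
    obtain ⟨m, hm, hξ⟩ := h0 c n
    refine ((point_le_upper ξ c (m + 1)).trans_lt ?_).trans_le (antitone_upper_branch ξ c hm)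
    rw [corner_branch_succ, hξ]
    have h3 : (1 : ℝ) / 2 ^ m = 1 / 2 ^ (m + 1) + 1 / 2 ^ (m + 1) := by field_simp; ring
    have h4 : (0 : ℝ) < 1 / 2 ^ (m + 1) := by positivity
    simp only [Fin.val_zero, Nat.cast_zero, zero_div, add_zero]
    linarith
  rw [corner_eq, length_branch] at hlt hgt
  rw [div_lt_iff₀' hp, hk] at hlt
  rw [← add_div, lt_div_iff₀' hp, hk] at hgt
  have e1 : position (branch ξ n) c < k := by exact_mod_cast hlt
  have e2 : k < position (branch ξ n) c + 1 := by exact_mod_cast hgt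
  omega

lemma Coding.mem_dom_of_generic (X : Coding d) {ξ : ℕ → Digit d} (h : Generic (point ξ)) :
    point ξ ∈ X.dom :=
  X.generic_mem _ (point_mem_cube ξ 0) h.notMem_frontier

lemma Coding.node_point (X : Coding d) {ξ : ℕ → Digit d} (h : Generic (point ξ)) (n : ℕ) :
    X.node (point ξ) n = branch ξ n :=
  h.eq_of_mem_cube (by simp [Coding.node]) (X.mem_cube _ (X.mem_dom_of_generic h) n)
    (point_mem_cube ξ n)

@[simp] lemma Coding.length_node (X : Coding d) (x : EuclideanSpace ℝ (Fin d)) (n : ℕ) :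
    (X.node x n).length = n := length_branch _ n

end DyadicTree

namespace DyadicTree

namespace RCM

variable {d : ℕ} {Ω : Type*}

/-! ### The constant solution -/

lemma fatherValue_append (f : ℝ) (u : Node d → ℝ) (j : Node d) (i : Digit d) :
    fatherValue f u (j ++ [i]) = u j := by
  simp [fatherValue]

lemma c_append (M : RCM d Ω) (α : ℝ) (j : Node d) (i : Digit d) :
    M.c α (j ++ [i]) = M.δ (M.label (j ++ [i])) * ((2 : ℝ) ^ (α * j.length) * 2 ^ α) := by
  rw [c, M.coeff_append, List.length_append, List.length_singleton,
    ← Real.rpow_add (by norm_num)]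
  push_cast
  ring_nf

lemma c_pos (M : RCM d Ω) (α : ℝ) (j : Node d) : 0 < M.c α j :=
  mul_pos (M.coeff_pos j) (Real.rpow_pos_of_pos (by norm_num) _)

lemma delta_rpow_three_halves (M : RCM d Ω) (ω : Ω) :
    M.δ ω ^ (3 / 2 : ℝ) = M.δ ω * √(M.δ ω) := by
  rw [Real.sqrt_eq_rpow, ← Real.rpow_one_add' (M.δ_pos ω).le (by norm_num)]
  norm_num

lemma IsConstantSolution.pos {M : RCM d Ω} {α f : ℝ} {u : Node d → ℝ}
    (hu : M.IsConstantSolution α f u) (hf : 0 < f) (j : Node d) :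
    0 < u j := by
  have key (j : Node d) (h : 0 < fatherValue f u j) : 0 < u j := by
    refine (hu.1 j).lt_of_ne fun h0 => ?_
    have h1 := hu.2 j
    have h2 := mul_pos (M.c_pos α j) (pow_pos h 2)
    simp only [← h0, mul_zero, zero_mul, Finset.sum_const_zero, sub_zero] at h1
    exact h2.ne h1
  induction j using List.reverseRecOn with
  | nil => exact key [] (by simpa [fatherValue] using hf)
  | append_singleton j i ih => exact key _ (by rwa [fatherValue_append])

lemma IsConstantSolution.fatherValue_pos {M : RCM d Ω} {α f : ℝ} {u : Node d → ℝ}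
    (hu : M.IsConstantSolution α f u) (hf : 0 < f) (j : Node d) : 0 < fatherValue f u j := by
  unfold fatherValue
  split_ifs
  · exact hf
  · exact hu.pos hf _

variable [Fintype Ω]

/-- The constant `β` for which `u j = β * √(d j) * u (father j)` is a constant solution. -/
noncomputable def slope (M : RCM d Ω) (α : ℝ) : ℝ :=
  ((2 : ℝ) ^ α * M.partition (3 / 2)) ^ (-(1 / 3) : ℝ)

lemma slope_pos (M : RCM d Ω) (α : ℝ) : 0 < M.slope α :=
  Real.rpow_pos_of_pos (mul_pos (Real.rpow_pos_of_pos (by norm_num) _) (M.partition_pos _)) _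

lemma slope_pow (M : RCM d Ω) (α : ℝ) :
    M.slope α ^ 3 * (2 ^ α * M.partition (3 / 2)) = 1 := by
  have h : 0 < (2 : ℝ) ^ α * M.partition (3 / 2) :=
    mul_pos (Real.rpow_pos_of_pos (by norm_num) _) (M.partition_pos _)
  rw [slope, ← Real.rpow_natCast, ← Real.rpow_mul h.le]
  norm_num
  rw [Real.rpow_neg_one]
  exact inv_mul_cancel₀ h.ne'

/-- The ratio of `u j` to the value `β * √(d j) * u (father j)` of the explicit solution. -/
noncomputable def defect (M : RCM d Ω) (α f : ℝ) (u : Node d → ℝ) (j : Node d) : ℝ :=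
  u j / (fatherValue f u j * (M.slope α * √(M.coeff j)))

section Solution

variable {M : RCM d Ω} {α f : ℝ} {u : Node d → ℝ}

lemma IsConstantSolution.defect_pos (hu : M.IsConstantSolution α f u) (hf : 0 < f) (j : Node d) :
    0 < M.defect α f u j :=
  div_pos (hu.pos hf j) (mul_pos (hu.fatherValue_pos hf j)
    (mul_pos (M.slope_pos α) (Real.sqrt_pos.2 (M.coeff_pos j))))

lemma IsConstantSolution.eq_defect_mul (hu : M.IsConstantSolution α f u) (hf : 0 < f)
    (j : Node d) :
    u j = M.defect α f u j * (fatherValue f u j * (M.slope α * √(M.coeff j))) :=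
  (div_mul_cancel₀ _ (mul_pos (hu.fatherValue_pos hf j)
    (mul_pos (M.slope_pos α) (Real.sqrt_pos.2 (M.coeff_pos j)))).ne').symm

/-- The stationary equation in terms of the defects: the mean of the defects of the offspring of
`j`, with the weights `gibbs (3 / 2)`, is the inverse square of the defect of `j`. -/
lemma IsConstantSolution.defect_eq (hu : M.IsConstantSolution α f u) (hf : 0 < f) (j : Node d) :
    M.defect α f u j ^ 2 * ∑ i : Digit d, M.gibbs (3 / 2) (M.label (j ++ [i])) *
      M.defect α f u (j ++ [i]) = 1 := by
  set q := M.defect α f u with hq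
  set S := ∑ i : Digit d, M.δ (M.label (j ++ [i])) ^ (3 / 2 : ℝ) * q (j ++ [i]) with hS
  have h1 : ∑ i : Digit d, M.gibbs (3 / 2) (M.label (j ++ [i])) * q (j ++ [i]) =
      S / M.partition (3 / 2) := by
    rw [hS, Finset.sum_div]
    exact Finset.sum_congr rfl fun i _ => by rw [gibbs]; ring
  have h2 : ∑ i : Digit d, M.c α (j ++ [i]) * u j * u (j ++ [i]) =
      (2 : ℝ) ^ (α * j.length) * 2 ^ α * u j ^ 2 * M.slope α * S := by
    rw [hS, Finset.mul_sum]
    refine Finset.sum_congr rfl fun i _ => ?_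
    rw [hu.eq_defect_mul hf (j ++ [i]), fatherValue_append, M.coeff_append, c_append,
      delta_rpow_three_halves]
    ring
  have h3 := hu.2 j
  rw [h2, c] at h3
  have hsq : √(M.coeff j) ^ 2 = M.coeff j := Real.sq_sqrt (M.coeff_pos j).le
  have h4 : u j ^ 2 = q j ^ 2 * fatherValue f u j ^ 2 * M.slope α ^ 2 * M.coeff j := by
    rw [hu.eq_defect_mul hf j, ← hq]
    linear_combination (q j ^ 2 * fatherValue f u j ^ 2 * M.slope α ^ 2) * hsq
  rw [h4] at h3
  have hA : 0 < M.coeff j * (2 : ℝ) ^ (α * j.length) * fatherValue f u j ^ 2 :=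
    mul_pos (mul_pos (M.coeff_pos j) (Real.rpow_pos_of_pos (by norm_num) _))
      (pow_pos (hu.fatherValue_pos hf j) 2)
  have h5 : q j ^ 2 * (M.slope α ^ 3 * 2 ^ α) * S = 1 := by
    refine mul_left_cancel₀ hA.ne' ?_
    linear_combination h3
  have h6 : M.slope α ^ 3 * 2 ^ α = (M.partition (3 / 2))⁻¹ := by
    have := M.slope_pow α
    rw [← mul_assoc] at this
    exact eq_inv_of_mul_eq_one_left this
  rw [h1, ← h5, h6]
  ring

lemma IsConstantSolution.exists_defect_le (hu : M.IsConstantSolution α f u) (hf : 0 < f)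
    (j : Node d) : ∃ i, M.defect α f u j ^ 2 * M.defect α f u (j ++ [i]) ≤ 1 := by
  by_contra! h
  have h1 := hu.defect_eq hf j
  have h2 := M.sum_label (M.gibbs (3 / 2)) j
  rw [M.sum_gibbs] at h2
  rw [Finset.mul_sum] at h1
  refine absurd (h2.trans h1.symm) (Finset.sum_lt_sum_of_nonempty Finset.univ_nonempty ?_).ne
  intro i _
  have := mul_lt_mul_of_pos_left (h i) (M.gibbs_pos (3 / 2) (M.label (j ++ [i])))
  linarith

lemma IsConstantSolution.exists_le_defect (hu : M.IsConstantSolution α f u) (hf : 0 < f)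
    (j : Node d) : ∃ i, 1 ≤ M.defect α f u j ^ 2 * M.defect α f u (j ++ [i]) := by
  by_contra! h
  have h1 := hu.defect_eq hf j
  have h2 := M.sum_label (M.gibbs (3 / 2)) j
  rw [M.sum_gibbs] at h2
  rw [Finset.mul_sum] at h1
  refine absurd (h1.trans h2.symm) (Finset.sum_lt_sum_of_nonempty Finset.univ_nonempty ?_).ne
  intro i _
  have := mul_lt_mul_of_pos_left (h i) (M.gibbs_pos (3 / 2) (M.label (j ++ [i])))
  linarith

/-- Two generations below a node of defect `q` there is a node of defect at least `q ^ 4`, where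
the solution has been multiplied by at least a constant times `q ^ 2`. -/
lemma IsConstantSolution.exists_grandchild (hu : M.IsConstantSolution α f u) (hf : 0 < f) (s : ℝ) :
    ∃ κ > 0, ∀ j : Node d, ∃ l : Node d, M.defect α f u j ^ 4 ≤ M.defect α f u l ∧
      κ * M.defect α f u j ^ 2 * ((2 : ℝ) ^ (s * j.length) * u j) ≤
        (2 : ℝ) ^ (s * l.length) * u l := by
  have := M.nonempty_label
  obtain ⟨ω₀, h₀⟩ := Finite.exists_min fun ω => M.δ ω
  refine ⟨M.slope α ^ 2 * M.δ ω₀ * 2 ^ (2 * s), by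
    have := M.slope_pos α
    have := M.δ_pos ω₀
    positivity, fun j => ?_⟩
  obtain ⟨i, hi⟩ := hu.exists_defect_le hf j
  obtain ⟨i', hi'⟩ := hu.exists_le_defect hf (j ++ [i])
  set q := M.defect α f u with hq
  set k := j ++ [i] with hk
  have hqk := hu.defect_pos hf k
  have hql := hu.defect_pos hf (k ++ [i'])
  rw [← hq] at hqk hql
  refine ⟨k ++ [i'], ?_, ?_⟩
  · calc q j ^ 4 ≤ q j ^ 4 * (q k ^ 2 * q (k ++ [i'])) :=
          le_mul_of_one_le_right (by positivity) hi'
      _ = (q j ^ 2 * q k) ^ 2 * q (k ++ [i']) := by ring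
      _ ≤ 1 * q (k ++ [i']) := by
          refine mul_le_mul_of_nonneg_right (pow_le_one₀ (by positivity) hi) hql.le
      _ = _ := one_mul _
  · have h1 : q j ^ 2 ≤ q k * q (k ++ [i']) := by
      calc q j ^ 2 ≤ q j ^ 2 * (q k ^ 2 * q (k ++ [i'])) :=
          le_mul_of_one_le_right (by positivity) hi'
        _ = (q j ^ 2 * q k) * (q k * q (k ++ [i'])) := by ring
        _ ≤ 1 * (q k * q (k ++ [i'])) := by gcongr
        _ = _ := one_mul _
    have h2 : u (k ++ [i']) = M.slope α ^ 2 * (√(M.δ (M.label k)) *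
        √(M.δ (M.label (k ++ [i'])))) * (q k * q (k ++ [i'])) * u j := by
      rw [hu.eq_defect_mul hf (k ++ [i']), fatherValue_append, hu.eq_defect_mul hf k, hk,
        fatherValue_append, M.coeff_append, M.coeff_append]
      ring
    have h3 : M.δ ω₀ ≤ √(M.δ (M.label k)) * √(M.δ (M.label (k ++ [i']))) := by
      rw [← Real.mul_self_sqrt (M.δ_pos ω₀).le]
      exact mul_le_mul (Real.sqrt_le_sqrt (h₀ _)) (Real.sqrt_le_sqrt (h₀ _)) (by positivity)
        (by positivity)
    have h4 : (2 : ℝ) ^ (s * (k ++ [i']).length) = 2 ^ (2 * s) * 2 ^ (s * j.length) := by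
      rw [hk, ← Real.rpow_add (by norm_num)]
      congr 1
      simp only [List.length_append, List.length_singleton]
      push_cast
      ring
    have h5 := hu.pos hf j
    have h6 := M.δ_pos ω₀
    rw [h2, h4]
    calc M.slope α ^ 2 * M.δ ω₀ * 2 ^ (2 * s) * q j ^ 2 * ((2 : ℝ) ^ (s * j.length) * u j)
        = 2 ^ (2 * s) * 2 ^ (s * j.length) * (M.slope α ^ 2 * M.δ ω₀ * q j ^ 2 * u j) := by ring
      _ ≤ _ := by gcongr

/-- A defect larger than `1` propagates to descendants with doubly exponential growth, which no
space `H^s` allows. -/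
lemma IsConstantSolution.defect_le_one (hu : M.IsConstantSolution α f u) (hf : 0 < f)
    (hs : ∃ s : ℝ, MemH s u) (j : Node d) : M.defect α f u j ≤ 1 := by
  by_contra! hj
  obtain ⟨s, hs⟩ := hs
  obtain ⟨κ, hκ, hstep⟩ := hu.exists_grandchild hf s
  set q := M.defect α f u with hq
  set v : Node d → ℝ := fun j => (2 : ℝ) ^ (s * j.length) * u j with hv
  have hvpos (j : Node d) : 0 < v j := mul_pos (Real.rpow_pos_of_pos (by norm_num) _) (hu.pos hf j)
  obtain ⟨T, hT⟩ : ∃ T, ∀ j, v j ^ 2 ≤ T := by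
    have e (j : Node d) : v j ^ 2 = (2 : ℝ) ^ (2 * s * (j.length : ℝ)) * u j ^ 2 := by
      rw [hv, mul_pow, ← Real.rpow_natCast, ← Real.rpow_mul (by norm_num)]
      push_cast
      ring_nf
    refine ⟨∑' j : Node d, v j ^ 2, fun j => ?_⟩
    have hs' : Summable fun j : Node d => v j ^ 2 := by
      simp_rw [e]
      exact hs
    exact hs'.le_tsum j fun i _ => sq_nonneg _
  -- The defects of the descendants are unbounded.
  have hlarge (n : ℕ) : ∃ l, q j ^ (n + 1) ≤ q l := by
    induction n with
    | zero => exact ⟨j, by simp⟩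
    | succ n ih =>
      obtain ⟨l, hl⟩ := ih
      obtain ⟨l', hl', -⟩ := hstep l
      have h1 : q j ≤ q l := (le_self_pow₀ hj.le (by omega)).trans hl
      have h2 : 1 ≤ q l := hj.le.trans h1
      refine ⟨l', le_trans ?_ hl'⟩
      calc q j ^ (n + 1 + 1) = q j ^ (n + 1) * q j := pow_succ _ _
        _ ≤ q l * q l := by gcongr
        _ = q l ^ 2 := by ring
        _ ≤ q l ^ 4 := pow_le_pow_right₀ h2 (by norm_num)
  obtain ⟨n, hn⟩ := pow_unbounded_of_one_lt (max 1 (2 / κ)) hj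
  obtain ⟨l, hl⟩ := hlarge n
  have hl0 : max 1 (2 / κ) ≤ q l :=
    hn.le.trans ((pow_le_pow_right₀ hj.le (Nat.le_succ n)).trans hl)
  -- From a node with a large defect on, every second generation at least doubles `v`.
  have hgrow (m : ℕ) : ∃ l', q l ≤ q l' ∧ 2 ^ m * v l ≤ v l' := by
    induction m with
    | zero => exact ⟨l, le_rfl, by simp⟩
    | succ m ih =>
      obtain ⟨k, hk, hkv⟩ := ih
      obtain ⟨k', hk', hkv'⟩ := hstep k
      have h1 : 1 ≤ q k := (le_max_left _ _).trans (hl0.trans hk)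
      have h2 : 2 ≤ κ * q k ^ 2 := by
        have := (le_max_right _ _).trans (hl0.trans hk)
        rw [div_le_iff₀ hκ] at this
        nlinarith
      refine ⟨k', hk.trans ((le_self_pow₀ h1 (by norm_num)).trans hk'), le_trans ?_ hkv'⟩
      calc 2 ^ (m + 1) * v l = 2 * (2 ^ m * v l) := by ring
        _ ≤ κ * q k ^ 2 * v k := mul_le_mul h2 hkv (by have := hvpos l; positivity) (by positivity)
  obtain ⟨m, hm⟩ := pow_unbounded_of_one_lt (max 1 T / v l) (one_lt_two)
  obtain ⟨l', -, hl'⟩ := hgrow m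
  rw [div_lt_iff₀ (hvpos l)] at hm
  have h1 : max 1 T < v l' := hm.trans_le hl'
  have h2 : 1 ≤ v l' := (le_max_left _ _).trans h1.le
  have h3 := (le_max_right 1 T).trans_lt h1
  have h4 := hT l'
  nlinarith

lemma IsConstantSolution.defect_eq_one (hu : M.IsConstantSolution α f u) (hf : 0 < f)
    (hs : ∃ s : ℝ, MemH s u) (j : Node d) : M.defect α f u j = 1 := by
  refine (hu.defect_le_one hf hs j).antisymm ?_
  by_contra! h
  obtain ⟨i, hi⟩ := hu.exists_le_defect hf j
  have h1 := hu.defect_le_one hf hs (j ++ [i])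
  have h2 := hu.defect_pos hf j
  have h3 : M.defect α f u j ^ 2 < 1 := pow_lt_one₀ h2.le h (by norm_num)
  have h4 := hu.defect_pos hf (j ++ [i])
  nlinarith

/-- Each node passes the dissipation on to its offspring in the proportions `gibbs (3 / 2)`. -/
lemma IsConstantSolution.dissipation_eq (hu : M.IsConstantSolution α f u) (hf : 0 < f)
    (hs : ∃ s : ℝ, MemH s u) (j : Node d) :
    M.dissipation α f u j = M.weight (M.gibbs (3 / 2)) j := by
  have hroot : 2 * M.c α [] * fatherValue f u [] ^ 2 * u [] ≠ 0 :=
    (mul_pos (mul_pos (mul_pos two_pos (M.c_pos α [])) (pow_pos (hu.fatherValue_pos hf []) 2))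
      (hu.pos hf [])).ne'
  induction j using List.reverseRecOn with
  | nil => rw [weight_nil, dissipation, div_self hroot]
  | append_singleton j i ih =>
    rw [weight_append, ← ih, dissipation, dissipation, div_mul_eq_mul_div]
    congr 1
    have h1 := hu.eq_defect_mul hf (j ++ [i])
    have h2 := hu.eq_defect_mul hf j
    rw [hu.defect_eq_one hf hs, one_mul] at h1 h2
    rw [fatherValue_append, M.coeff_append] at h1
    have h3 := M.slope_pow α
    have h4 : u j ^ 2 = fatherValue f u j ^ 2 * M.slope α ^ 2 * M.coeff j := by
      rw [h2, ← Real.sq_sqrt (M.coeff_pos j).le, Real.sqrt_sq (Real.sqrt_nonneg _)]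
      ring
    have hZ := M.partition_pos (3 / 2)
    rw [fatherValue_append, c_append, h1, gibbs, delta_rpow_three_halves, ← mul_div_assoc,
      eq_div_iff hZ.ne', c, h4]
    linear_combination (2 * M.coeff j * 2 ^ (α * (j.length : ℝ)) * fatherValue f u j ^ 2 * u j *
      M.δ (M.label (j ++ [i])) * √(M.δ (M.label (j ++ [i])))) * h3

end Solution

/-! ### Concentration of the dissipation -/

/-- The law of large numbers for `σ` under a product weight. -/
lemma tendsto_sum_weight_indicator (M : RCM d Ω) {p : Ω → ℝ} (hp : p ∈ stdSimplex ℝ Ω)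
    {B : Set ℝ} (hB : B ∈ 𝓝 (M.sigma p)) :
    Tendsto (fun n : ℕ => ∑ j : Fin n → Digit d,
      B.indicator (fun _ => M.weight p (List.ofFn j)) (M.sigmaNode (List.ofFn j))) atTop (𝓝 1) := by
  obtain ⟨ε, hε, hεB⟩ := Metric.mem_nhds_iff.1 hB
  set a := M.sigma p with ha
  set g : Ω → ℝ := fun ω => Real.logb 2 (M.δ ω) - a with hg
  have hg0 : ∑ ω, p ω * g ω = 0 := by
    simp only [hg, mul_sub, Finset.sum_sub_distrib, ← Finset.sum_mul, hp.2, one_mul]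
    exact sub_self a
  set V := ∑ ω, p ω * g ω ^ 2 with hV
  have hw (j : Node d) : 0 ≤ M.weight p j := Finset.prod_nonneg fun _ _ => hp.1 _
  have hlow : Tendsto (fun n : ℕ => 1 - V / ε ^ 2 / n) atTop (𝓝 1) := by
    simpa using (tendsto_const_div_atTop_nhds_zero_nat (V / ε ^ 2)).const_sub 1
  refine tendsto_of_tendsto_of_tendsto_of_le_of_le' hlow tendsto_const_nhds ?_ ?_
  · filter_upwards [eventually_gt_atTop 0] with n hn
    have hn' : (0 : ℝ) < n := by exact_mod_cast hn
    -- Chebyshev's inequality, node by node.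
    have key (j : Fin n → Digit d) : M.weight p (List.ofFn j) -
        M.weight p (List.ofFn j) * M.labelSum g (List.ofFn j) ^ 2 / (n * ε) ^ 2 ≤
        B.indicator (fun _ => M.weight p (List.ofFn j)) (M.sigmaNode (List.ofFn j)) := by
      by_cases hj : M.sigmaNode (List.ofFn j) ∈ B
      · rw [Set.indicator_of_mem hj]
        have := hw (List.ofFn j)
        exact sub_le_self _ (by positivity)
      · rw [Set.indicator_of_notMem hj, sub_nonpos, le_div_iff₀ (by positivity)]
        refine mul_le_mul_of_nonneg_left ?_ (hw _)
        have h1 : ε ≤ |M.sigmaNode (List.ofFn j) - a| := by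
          by_contra! h
          exact hj (hεB (by rwa [Metric.mem_ball, Real.dist_eq]))
        have h2 : M.labelSum g (List.ofFn j) = n * (M.sigmaNode (List.ofFn j) - a) := by
          rw [hg, labelSum_sub_const, sigmaNode_eq, List.length_ofFn]
          field_simp
        rw [h2, mul_pow, mul_pow, ← sq_abs (M.sigmaNode (List.ofFn j) - a)]
        gcongr
    refine le_trans (le_of_eq ?_) (Finset.sum_le_sum fun j _ => key j)
    rw [Finset.sum_sub_distrib, M.sum_weight hp.2, ← Finset.sum_div,
      M.sum_weight_mul_labelSum_sq hp.2 hg0, ← hV]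
    field_simp
  · refine Eventually.of_forall fun n => ?_
    rw [← M.sum_weight hp.2 n]
    exact Finset.sum_le_sum fun j _ => Set.indicator_le_self' (fun _ _ => hw _) _

lemma IsConstantSolution.carriesDissipation_iff {M : RCM d Ω} {α f : ℝ} {u : Node d → ℝ}
    (hu : M.IsConstantSolution α f u) (hf : 0 < f) (hs : ∃ s : ℝ, MemH s u) (a : ℝ) :
    M.CarriesDissipation α f u a ↔ a = M.phi (3 / 2) := by
  set p := M.gibbs (3 / 2) with hp
  have hps : p ∈ stdSimplex ℝ Ω := (M.gibbs_mem_level (3 / 2)).1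
  have hw (j : Node d) : 0 ≤ M.weight p j := Finset.prod_nonneg fun _ _ => hps.1 _
  simp only [CarriesDissipation, hu.dissipation_eq hf hs, ← hp]
  constructor
  · intro h
    by_contra hne
    obtain ⟨U, V, hU, hV, ha, hφ, hUV⟩ := t2_separation hne
    -- Two disjoint neighbourhoods would each carry the whole mass `1`.
    have h1 := (h U (hU.mem_nhds ha)).add
      (M.tendsto_sum_weight_indicator hps (B := V) (hV.mem_nhds hφ))
    have h2 := le_of_tendsto' h1 (b := 1) fun n => by
      rw [← Finset.sum_add_distrib, ← M.sum_weight hps.2 n]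
      refine Finset.sum_le_sum fun j _ => ?_
      have e := congrFun (Set.indicator_union_of_disjoint hUV fun _ => M.weight p (List.ofFn j))
        (M.sigmaNode (List.ofFn j))
      rw [← e]
      exact Set.indicator_le_self' (fun _ _ => hw _) _
    norm_num at h2
  · rintro rfl B hB
    exact M.tendsto_sum_weight_indicator hps hB

end RCM

end DyadicTree

namespace DyadicTree

open MeasureTheory

namespace RCM

variable {d : ℕ} {Ω : Type*} [Fintype Ω]

/-! ### The upper bound for the dimension -/

/-- As the frequencies stay in a compact set, `σ` converges along the branch of any point all of
whose asymptotic frequencies are in `𝕊_a`. -/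
lemma tendsto_labelSum_of_mem_E (M : RCM d Ω) {X : Coding d} {a : ℝ}
    {x : EuclideanSpace ℝ (Fin d)} (hx : x ∈ M.E X a) :
    Tendsto (fun n : ℕ => M.labelSum (fun ω => Real.logb 2 (M.δ ω)) (X.node x n) / n) atTop
      (𝓝 a) := by
  have hcont : Continuous M.sigma := by unfold sigma; fun_prop
  have h : Tendsto (fun n : ℕ => M.sigma (M.freq (X.node x n))) atTop (𝓝 a) := by
    rw [Metric.tendsto_nhds]
    intro ε hε
    by_contra hev
    rw [not_eventually] at hev
    set K : Set (Ω → ℝ) := Set.Icc 0 1 ∩ {p | ε ≤ dist (M.sigma p) a} with hK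
    have hKc : IsCompact K :=
      isCompact_Icc.inter_right (isClosed_le continuous_const (hcont.dist continuous_const))
    obtain ⟨p, hpK, hp⟩ := hKc.exists_mapClusterPt_of_frequently
      (f := fun n : ℕ => M.freq (X.node x n)) (l := atTop) (hev.mono fun n hn =>
        ⟨⟨fun ω => (M.freq_mem_Icc _ ω).1, fun ω => (M.freq_mem_Icc _ ω).2⟩, not_lt.1 hn⟩)
    have := (hx.2 hp).2
    have h2 : ε ≤ dist (M.sigma p) a := hpK.2
    rw [this, dist_self] at h2
    exact h2.not_gt hε
  refine h.congr fun n => ?_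
  rw [sigma_freq, Coding.length_node]

/-- The points of the domain of the coding whose cubes have weight at least `2 ^ (-n t)` from
generation `n₀` on form a set of dimension at most `t`: at most `2 ^ (n t)` cubes of
generation `n` have such a weight. -/
lemma dimH_weight_ge_le (M : RCM d Ω) (X : Coding d) {p : Ω → ℝ} (hp : p ∈ stdSimplex ℝ Ω)
    (t : NNReal) (n₀ : ℕ) :
    dimH {x | x ∈ X.dom ∧ ∀ n ≥ n₀, (2 : ℝ) ^ (-(n * t : ℝ)) ≤ M.weight p (X.node x n)} ≤ t := by
  classical
  set S := {x | x ∈ X.dom ∧ ∀ n ≥ n₀, (2 : ℝ) ^ (-(n * t : ℝ)) ≤ M.weight p (X.node x n)} with hS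
  have hw (j : Node d) : 0 ≤ M.weight p j := Finset.prod_nonneg fun _ _ => hp.1 _
  let ι (n : ℕ) := {j : Fin n → Digit d // (2 : ℝ) ^ (-(n * t : ℝ)) ≤ M.weight p (List.ofFn j)}
  have hcard (n : ℕ) : (Fintype.card (ι n) : ℝ) * 2 ^ (-(n * t : ℝ)) ≤ 1 := by
    calc (Fintype.card (ι n) : ℝ) * 2 ^ (-(n * t : ℝ))
        = ∑ _j : ι n, (2 : ℝ) ^ (-(n * t : ℝ)) := by simp
      _ ≤ ∑ j : ι n, M.weight p (List.ofFn j.1) := Finset.sum_le_sum fun j _ => j.2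
      _ ≤ ∑ j : Fin n → Digit d, M.weight p (List.ofFn j) := by
          refine (Finset.sum_map Finset.univ (Function.Embedding.subtype _)
            fun j => M.weight p (List.ofFn j)).symm.trans_le ?_
          exact Finset.sum_le_sum_of_subset_of_nonneg (Finset.subset_univ _) fun j _ _ => hw _
      _ = 1 := M.sum_weight hp.2 n
  have hr : Tendsto (fun n : ℕ => ENNReal.ofReal (√d * (1 / 2 ^ n))) atTop (𝓝 0) := by
    rw [← ENNReal.ofReal_zero]
    refine ENNReal.tendsto_ofReal ?_
    have := (tendsto_pow_atTop_nhds_zero_of_lt_one (r := (1 / 2 : ℝ)) (by norm_num)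
      (by norm_num)).const_mul (√d)
    simpa [div_pow] using this
  have hdiam (n : ℕ) (j : ι n) :
      Metric.ediam (cube (List.ofFn j.1)) ≤ ENNReal.ofReal (√d * (1 / 2 ^ n)) := by
    simpa using ediam_cube_le (List.ofFn j.1)
  refine dimH_le_of_hausdorffMeasure_ne_top (ne_top_of_le_ne_top
    (b := ENNReal.ofReal (√d ^ (t : ℝ))) ENNReal.ofReal_ne_top ?_)
  refine (Measure.hausdorffMeasure_le_liminf_sum (ι := ι) (t : ℝ) S _ hr
    (fun n j => cube (List.ofFn j.1)) (Eventually.of_forall hdiam) ?_).trans ?_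
  · filter_upwards [eventually_ge_atTop n₀] with n hn x hx
    exact Set.mem_iUnion.2 ⟨⟨fun m => X.digits x m, hx.2 n hn⟩, X.mem_cube x hx.1 n⟩
  · refine (liminf_le_liminf (Eventually.of_forall fun n => ?_)).trans
      (liminf_const (ENNReal.ofReal (√d ^ (t : ℝ)))).le
    calc ∑ j : ι n, Metric.ediam (cube (List.ofFn j.1)) ^ (t : ℝ)
        ≤ ∑ _j : ι n, ENNReal.ofReal (√d * (1 / 2 ^ n)) ^ (t : ℝ) :=
          Finset.sum_le_sum fun j _ => ENNReal.rpow_le_rpow (hdiam n j) t.coe_nonneg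
      _ = ENNReal.ofReal (Fintype.card (ι n) * (√d * (1 / 2 ^ n)) ^ (t : ℝ)) := by
          rw [ENNReal.ofReal_mul (p := (Fintype.card (ι n) : ℝ)) (by positivity),
            ENNReal.ofReal_natCast,
            ← ENNReal.ofReal_rpow_of_nonneg (by positivity) t.coe_nonneg]
          simp
      _ ≤ ENNReal.ofReal (√d ^ (t : ℝ)) := by
          refine ENNReal.ofReal_le_ofReal ?_
          have e : (1 / 2 ^ n : ℝ) ^ (t : ℝ) = 2 ^ (-(n * t : ℝ)) := by
            rw [Real.rpow_neg (by norm_num), Real.rpow_mul (by norm_num), Real.rpow_natCast,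
              one_div, Real.inv_rpow (by positivity)]
          rw [Real.mul_rpow (by positivity) (by positivity), e, mul_left_comm]
          exact mul_le_of_le_one_right (by positivity) (hcard n)

lemma dimH_E_le_pressure (M : RCM d Ω) (X : Coding d) (a γ : ℝ) :
    dimH (M.E X a) ≤ ENNReal.ofReal (M.pressure γ - γ * a) := by
  refine ENNReal.le_of_forall_pos_le_add fun ε hε _ => ?_
  set t : NNReal := (M.pressure γ - γ * a).toNNReal + ε with ht
  have hlt : M.pressure γ - γ * a < t := by
    have h1 := Real.le_coe_toNNReal (M.pressure γ - γ * a)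
    have h2 : (0 : ℝ) < ε := hε
    rw [ht]
    push_cast
    linarith
  have hE : M.E X a ⊆ ⋃ n₀ : ℕ, {x | x ∈ X.dom ∧ ∀ n ≥ n₀,
      (2 : ℝ) ^ (-(n * t : ℝ)) ≤ M.weight (M.gibbs γ) (X.node x n)} := by
    intro x hx
    have h1 := ((M.tendsto_labelSum_of_mem_E hx).const_mul γ).sub_const (M.pressure γ)
    have h2 := h1.eventually (lt_mem_nhds (show -(t : ℝ) < γ * a - M.pressure γ by linarith))
    obtain ⟨n₀, h₀⟩ := eventually_atTop.1 (h2.and (eventually_gt_atTop 0))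
    refine Set.mem_iUnion.2 ⟨n₀, hx.1, fun n hn => ?_⟩
    obtain ⟨h3, h4⟩ := h₀ n hn
    have hn' : (0 : ℝ) < n := by exact_mod_cast h4
    rw [M.weight_eq_rpow (M.gibbs_pos γ)]
    refine Real.rpow_le_rpow_of_exponent_le (by norm_num) ?_
    simp only [logb_gibbs]
    rw [labelSum_sub_const, labelSum_const_mul, Coding.length_node]
    calc -(n * t : ℝ) = n * -t := by ring
      _ ≤ n * (γ * (M.labelSum (fun ω => Real.logb 2 (M.δ ω)) (X.node x n) / n) - M.pressure γ) :=
        mul_le_mul_of_nonneg_left h3.le hn'.le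
      _ = _ := by field_simp
  refine (dimH_mono hE).trans ?_
  rw [dimH_iUnion]
  refine iSup_le fun n₀ => (M.dimH_weight_ge_le X (M.gibbs_mem_level γ).1 t n₀).trans_eq ?_
  rw [ht]
  rfl

end RCM

end DyadicTree

namespace DyadicTree

open MeasureTheory

/-! ### The lower bound for the dimension -/

/-- The mass distribution principle. -/
lemma le_dimH_of_measure_le {Y : Type*} [MetricSpace Y] [MeasurableSpace Y] [BorelSpace Y]
    (ν : Measure Y) (t : NNReal) {C ε : ENNReal} (hC0 : C ≠ 0) (hC : C ≠ ⊤) (hε : 0 < ε)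
    (h : ∀ s : Set Y, IsClosed s → Metric.ediam s ≤ ε → ν s ≤ C * Metric.ediam s ^ (t : ℝ))
    {E : Set Y} (hE : ν E ≠ 0) : t ≤ dimH E := by
  have hle : C⁻¹ • ν ≤ Measure.hausdorffMeasure (t : ℝ) := by
    refine Measure.le_hausdorffMeasure _ _ ε hε fun s hs => ?_
    have h1 := h (closure s) isClosed_closure (by rwa [Metric.ediam_closure])
    rw [Metric.ediam_closure] at h1
    rw [Measure.smul_apply, smul_eq_mul, ENNReal.inv_mul_le_iff hC0 hC]
    exact (measure_mono subset_closure).trans h1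
  refine le_dimH_of_hausdorffMeasure_ne_zero fun h0 => ?_
  have h1 := (hle E).trans_eq h0
  rw [Measure.smul_apply, smul_eq_mul, nonpos_iff_eq_zero, mul_eq_zero] at h1
  exact h1.elim (ENNReal.inv_ne_zero.2 hC) hE

/-- Changing the terms of a bounded sequence at the squares does not change its asymptotic mean. -/
lemma tendsto_sum_div_of_square {e : ℕ → ℝ} {C : ℝ} (hC : ∀ m, |e m| ≤ C)
    (h0 : ∀ m, ¬ IsSquare m → e m = 0) :
    Tendsto (fun n : ℕ => (∑ m ∈ Finset.range n, e m) / n) atTop (𝓝 0) := by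
  have hC0 : 0 ≤ C := (abs_nonneg _).trans (hC 0)
  have hbound (n : ℕ) : |∑ m ∈ Finset.range n, e m| ≤ C * (√n + 1) := by
    have hsub : (Finset.range n).filter IsSquare ⊆
        (Finset.range (Nat.sqrt n + 1)).image fun k => k * k := by
      intro m hm
      obtain ⟨hmn, k, rfl⟩ := Finset.mem_filter.1 hm
      refine Finset.mem_image.2 ⟨k, Finset.mem_range.2 (Nat.lt_succ_of_le ?_), rfl⟩
      exact Nat.le_sqrt.2 (Finset.mem_range.1 hmn).le
    have hcard : ((Finset.range n).filter IsSquare).card ≤ Nat.sqrt n + 1 :=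
      (Finset.card_le_card hsub).trans (Finset.card_image_le.trans_eq (Finset.card_range _))
    calc |∑ m ∈ Finset.range n, e m| = |∑ m ∈ (Finset.range n).filter IsSquare, e m| := by
          rw [Finset.sum_filter_of_ne fun m _ hm => by_contra fun h => hm (h0 m h)]
      _ ≤ ∑ m ∈ (Finset.range n).filter IsSquare, C :=
          (Finset.abs_sum_le_sum_abs _ _).trans (Finset.sum_le_sum fun m _ => hC m)
      _ = ((Finset.range n).filter IsSquare).card * C := by simp
      _ ≤ (Nat.sqrt n + 1 : ℕ) * C := by gcongr
      _ ≤ C * (√n + 1) := by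
          rw [mul_comm]
          push_cast
          gcongr
          exact Real.nat_sqrt_le_real_sqrt
  have hlim : Tendsto (fun n : ℕ => C * ((√n)⁻¹ + 1 / n)) atTop (𝓝 0) := by
    have h1 : Tendsto (fun n : ℕ => (√(n : ℝ))⁻¹) atTop (𝓝 0) :=
      tendsto_inv_atTop_zero.comp (Real.tendsto_sqrt_atTop.comp tendsto_natCast_atTop_atTop)
    simpa using (h1.add tendsto_one_div_atTop_nhds_zero_nat).const_mul C
  refine squeeze_zero_norm (fun n => ?_) hlim
  rw [Real.norm_eq_abs, abs_div, Nat.abs_cast]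
  rcases n.eq_zero_or_pos with rfl | hn
  · simp
  · have hn' : (0 : ℝ) < n := by exact_mod_cast hn
    rw [div_le_iff₀ hn']
    refine (hbound n).trans_eq ?_
    have : (√(n : ℝ)) ^ 2 = n := Real.sq_sqrt hn'.le
    have h3 : 0 < √(n : ℝ) := Real.sqrt_pos.2 hn'
    rw [mul_assoc, add_mul, one_div, inv_mul_cancel₀ hn'.ne']
    congr 2
    field_simp
    exact this

namespace RCM

variable {d : ℕ} {Ω : Type*}

/-- The offspring of `j` with label `o`, except that in square generations the choice is forced:
the first, or the last, of the offspring. The forced choices keep the points of the resulting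
branches off the boundaries of the cubes, and are too rare to influence any mean value. -/
noncomputable def nextDigit (M : RCM d Ω) (j : Node d) (o : Ω) : Digit d :=
  if IsSquare j.length then fun _ => if Even (Nat.sqrt j.length) then 0 else 1
  else (Equiv.ofBijective _ (M.label_bijective j)).symm o

/-- The nodes of the branch which follows the sequence of labels `η`. -/
noncomputable def path (M : RCM d Ω) (η : ℕ → Ω) : ℕ → Node d
  | 0 => []
  | n + 1 => path M η n ++ [M.nextDigit (path M η n) (η n)]

/-- The digits of the branch which follows the sequence of labels `η`. -/
noncomputable def pathDigits (M : RCM d Ω) (η : ℕ → Ω) (n : ℕ) : Digit d :=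
  M.nextDigit (M.path η n) (η n)

lemma path_eq_branch (M : RCM d Ω) (η : ℕ → Ω) (n : ℕ) :
    M.path η n = branch (M.pathDigits η) n := by
  induction n with
  | zero => rfl
  | succ n ih => rw [branch_succ, ← ih]; rfl

@[simp] lemma length_path (M : RCM d Ω) (η : ℕ → Ω) (n : ℕ) : (M.path η n).length = n := by
  rw [path_eq_branch, length_branch]

lemma label_path (M : RCM d Ω) (η : ℕ → Ω) {n : ℕ} (hn : ¬ IsSquare n) :
    M.label (M.path η (n + 1)) = η n := by
  rw [path, nextDigit, length_path, if_neg hn]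
  exact (Equiv.ofBijective _ (M.label_bijective (M.path η n))).apply_symm_apply (η n)

lemma path_congr (M : RCM d Ω) {η η' : ℕ → Ω} {n : ℕ} (h : ∀ m < n, η m = η' m) :
    M.path η n = M.path η' n := by
  induction n with
  | zero => rfl
  | succ n ih => rw [path, path, ih fun m hm => h m (by omega), h n (by omega)]

lemma path_eq_of_le (M : RCM d Ω) {η η' : ℕ → Ω} {m n : ℕ} (hmn : m ≤ n)
    (h : M.path η n = M.path η' n) : M.path η m = M.path η' m := by
  induction n, hmn using Nat.le_induction with
  | base => exact h
  | succ n _ ih =>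
    refine ih ?_
    have := congrArg List.dropLast h
    rwa [path, path, List.dropLast_concat, List.dropLast_concat] at this

lemma generic_path (M : RCM d Ω) (η : ℕ → Ω) : Generic (point (M.pathDigits η)) := by
  refine generic_point (fun c n => ⟨2 * n * (2 * n), by nlinarith, ?_⟩)
    (fun c n => ⟨(2 * n + 1) * (2 * n + 1), by nlinarith, ?_⟩)
  · rw [pathDigits, nextDigit, length_path, if_pos ⟨_, rfl⟩, Nat.sqrt_eq, if_pos (even_two_mul n)]
  · rw [pathDigits, nextDigit, length_path, if_pos ⟨_, rfl⟩, Nat.sqrt_eq,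
      if_neg (Nat.not_even_two_mul_add_one n)]

lemma labelSum_path (M : RCM d Ω) (g : Ω → ℝ) (η : ℕ → Ω) (n : ℕ) :
    M.labelSum g (M.path η n) = ∑ m ∈ Finset.range n, g (M.label (M.path η (m + 1))) := by
  induction n with
  | zero => simp [path]
  | succ n ih => rw [Finset.sum_range_succ, ← ih]; exact M.labelSum_append g _ _

variable [Fintype Ω]

lemma exists_abs_le (g : Ω → ℝ) : ∃ C, ∀ ω, |g ω| ≤ C :=
  ⟨∑ ω, |g ω|, fun ω => Finset.single_le_sum (fun i _ => abs_nonneg (g i)) (Finset.mem_univ ω)⟩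

lemma tendsto_labelSum_path (M : RCM d Ω) {g : Ω → ℝ} {η : ℕ → Ω} {b : ℝ}
    (h : Tendsto (fun n : ℕ => (∑ m ∈ Finset.range n, g (η m)) / n) atTop (𝓝 b)) :
    Tendsto (fun n : ℕ => M.labelSum g (M.path η n) / n) atTop (𝓝 b) := by
  obtain ⟨C, hC⟩ := exists_abs_le g
  have h1 := tendsto_sum_div_of_square
    (e := fun m => g (M.label (M.path η (m + 1))) - g (η m)) (C := C + C)
    (fun m => (abs_sub _ _).trans (add_le_add (hC _) (hC _)))
    (fun m hm => by rw [M.label_path η hm, sub_self])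
  refine ((h.add h1).congr fun n => ?_).trans_eq (by rw [add_zero])
  rw [labelSum_path, Finset.sum_sub_distrib]
  ring

/-- The probability that independent labels of law `p` agree with `η` in the generations smaller
than `n` where the labels matter. -/
noncomputable def pathMass (p : Ω → ℝ) (η : ℕ → Ω) (n : ℕ) : ℝ :=
  ∏ m ∈ (Finset.range n).filter (fun m => ¬ IsSquare m), p (η m)

/-- Where `log₂ p` has mean `-H`, the mass decays like `2 ^ (-n H)`. -/
lemma eventually_pathMass_le {p : Ω → ℝ} (hp : ∀ ω, 0 ≤ p ω) {η : ℕ → Ω} {H t : ℝ} (ht : t < H)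
    (h : Tendsto (fun n : ℕ => (∑ m ∈ Finset.range n, Real.logb 2 (p (η m))) / n) atTop (𝓝 (-H))) :
    ∀ᶠ n : ℕ in atTop, pathMass p η n ≤ 2 ^ (-(n * t : ℝ)) := by
  obtain ⟨C, hC⟩ := exists_abs_le fun ω => Real.logb 2 (p ω)
  have hC0 : 0 ≤ C := (abs_nonneg _).trans (hC (η 0))
  have h1 := tendsto_sum_div_of_square
    (e := fun m => if IsSquare m then Real.logb 2 (p (η m)) else 0) (C := C)
    (fun m => by split_ifs; exacts [hC _, by simpa using hC0])
    (fun m hm => if_neg hm)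
  have h2 := h.sub h1
  rw [sub_zero] at h2
  filter_upwards [h2.eventually (gt_mem_nhds (neg_lt_neg ht)), eventually_gt_atTop 0] with n hn hn0
  have hn' : (0 : ℝ) < n := by exact_mod_cast hn0
  have h3 : pathMass p η n ≤ 2 ^ ∑ m ∈ (Finset.range n).filter (fun m => ¬ IsSquare m),
      Real.logb 2 (p (η m)) := by
    rw [Real.rpow_sum_of_pos (by norm_num)]
    refine Finset.prod_le_prod (fun m _ => hp _) fun m _ => ?_
    rcases (hp (η m)).eq_or_lt with h0 | h0
    -- `logb 2 0 = 0`, so that the bound also holds where `p` vanishes.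
    · simp [← h0]
    · exact (Real.rpow_logb (by norm_num) (by norm_num) h0).ge
  refine h3.trans (Real.rpow_le_rpow_of_exponent_le (by norm_num) ?_)
  rw [← sub_div, div_lt_iff₀ hn', ← Finset.sum_filter] at hn
  have h4 := Finset.sum_filter_add_sum_filter_not (Finset.range n) IsSquare
    fun m => Real.logb 2 (p (η m))
  linarith

section Probability

variable [MeasurableSpace Ω]

/-- The law of a label. -/
noncomputable def labelLaw {p : Ω → ℝ} (hp : p ∈ stdSimplex ℝ Ω) : Measure Ω :=
  (PMF.ofFintype (fun ω => ENNReal.ofReal (p ω)) (by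
    rw [← ENNReal.ofReal_sum_of_nonneg fun ω _ => hp.1 ω, hp.2, ENNReal.ofReal_one])).toMeasure

instance {p : Ω → ℝ} (hp : p ∈ stdSimplex ℝ Ω) : IsProbabilityMeasure (labelLaw hp) :=
  PMF.toMeasure.isProbabilityMeasure _

/-- The law of a sequence of independent labels. -/
noncomputable def pathLaw {p : Ω → ℝ} (hp : p ∈ stdSimplex ℝ Ω) : Measure (ℕ → Ω) :=
  Measure.infinitePi fun _ => labelLaw hp

lemma map_eval_pathLaw {p : Ω → ℝ} (hp : p ∈ stdSimplex ℝ Ω) (m : ℕ) :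
    (pathLaw hp).map (fun η => η m) = labelLaw hp :=
  Measure.infinitePi_map_eval (fun _ => labelLaw hp) m

variable [DiscreteMeasurableSpace Ω]

lemma measurable_point_path (M : RCM d Ω) :
    Measurable fun η : ℕ → Ω => point (M.pathDigits η) := by
  have h1 (n : ℕ) (c : Fin d) :
      Measurable fun η : ℕ → Ω => corner (branch (M.pathDigits η) n) c := by
    -- The corner depends on the first `n` labels only.
    let ext (ζ : Fin n → Ω) : ℕ → Ω := fun m => if h : m < n then ζ ⟨m, h⟩ else M.label []
    have h2 : (fun η : ℕ → Ω => corner (branch (M.pathDigits η) n) c) =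
        (fun ζ : Fin n → Ω => corner (M.path (ext ζ) n) c) ∘ fun η (m : Fin n) => η m := by
      funext η
      simp only [Function.comp, ← path_eq_branch]
      rw [M.path_congr fun m hm => ?_]
      simp [ext, hm]
    rw [h2]
    exact (Measurable.of_discrete).comp (by fun_prop)
  have h3 : Measurable fun (η : ℕ → Ω) (c : Fin d) => point (M.pathDigits η) c :=
    measurable_pi_lambda _ fun c => measurable_of_tendsto_metrizable (fun n => h1 n c)
      (tendsto_pi_nhds.2 fun η => tendsto_corner_branch (M.pathDigits η) c)
  exact (WithLp.measurable_toLp 2 _).comp h3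

lemma labelLaw_singleton {p : Ω → ℝ} (hp : p ∈ stdSimplex ℝ Ω) (ω : Ω) :
    labelLaw hp {ω} = ENNReal.ofReal (p ω) := by
  rw [labelLaw, PMF.toMeasure_apply_singleton _ _ (MeasurableSet.singleton _), PMF.ofFintype_apply]

lemma pairwise_indepFun_pathLaw {p : Ω → ℝ} (hp : p ∈ stdSimplex ℝ Ω) (g : Ω → ℝ) :
    Pairwise fun m n : ℕ => ProbabilityTheory.IndepFun (fun η : ℕ → Ω => g (η m))
      (fun η => g (η n)) (pathLaw hp) := fun _ _ hmn =>
  (ProbabilityTheory.iIndepFun_infinitePi (P := fun _ : ℕ => labelLaw hp)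
    (X := fun _ => g) fun _ => Measurable.of_discrete).indepFun hmn

lemma integral_pathLaw {p : Ω → ℝ} (hp : p ∈ stdSimplex ℝ Ω) (g : Ω → ℝ) (m : ℕ) :
    Integrable (fun η => g (η m)) (pathLaw hp) ∧
      ∫ η, g (η m) ∂(pathLaw hp) = ∑ ω, p ω * g ω := by
  have hev : Measurable fun η : ℕ → Ω => η m := measurable_pi_apply m
  have hg : Measurable g := Measurable.of_discrete
  have hint : Integrable g (labelLaw hp) := Integrable.of_finite
  constructor
  · have : Integrable g ((pathLaw hp).map fun η => η m) := by rwa [map_eval_pathLaw]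
    exact this.comp_measurable hev
  · rw [← integral_map (f := g) hev.aemeasurable hg.aestronglyMeasurable, map_eval_pathLaw,
      integral_fintype hint]
    refine Finset.sum_congr rfl fun ω _ => ?_
    rw [Measure.real, labelLaw_singleton, ENNReal.toReal_ofReal (hp.1 ω), smul_eq_mul]

lemma identDistrib_pathLaw {p : Ω → ℝ} (hp : p ∈ stdSimplex ℝ Ω) (g : Ω → ℝ) (m : ℕ) :
    ProbabilityTheory.IdentDistrib (fun η : ℕ → Ω => g (η m)) (fun η : ℕ → Ω => g (η 0))
      (pathLaw hp) (pathLaw hp) := by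
  have h : ProbabilityTheory.IdentDistrib (fun η : ℕ → Ω => η m) (fun η : ℕ → Ω => η 0)
      (pathLaw hp) (pathLaw hp) :=
    ⟨(measurable_pi_apply m).aemeasurable, (measurable_pi_apply 0).aemeasurable,
      by rw [map_eval_pathLaw, map_eval_pathLaw]⟩
  exact h.comp Measurable.of_discrete

lemma ae_tendsto_mean {p : Ω → ℝ} (hp : p ∈ stdSimplex ℝ Ω) (g : Ω → ℝ) :
    ∀ᵐ η ∂(pathLaw hp), Tendsto (fun n : ℕ => (∑ m ∈ Finset.range n, g (η m)) / n) atTop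
      (𝓝 (∑ ω, p ω * g ω)) := by
  rw [← (integral_pathLaw hp g 0).2]
  exact ProbabilityTheory.strong_law_ae_real (fun m (η : ℕ → Ω) => g (η m))
    (integral_pathLaw hp g 0).1 (pairwise_indepFun_pathLaw hp g) (identDistrib_pathLaw hp g)

lemma pathLaw_path_eq_le (M : RCM d Ω) {p : Ω → ℝ} (hp : p ∈ stdSimplex ℝ Ω) (η : ℕ → Ω) (n : ℕ) :
    pathLaw hp {η' | M.path η' n = M.path η n} ≤ ENNReal.ofReal (pathMass p η n) := by
  set s := (Finset.range n).filter (fun m => ¬ IsSquare m) with hs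
  calc pathLaw hp {η' | M.path η' n = M.path η n}
      ≤ pathLaw hp (Set.pi s fun m => {η m}) := by
        refine measure_mono fun η' h m hm => ?_
        obtain ⟨hmn, hm⟩ := Finset.mem_filter.1 hm
        have := M.path_eq_of_le (Nat.succ_le_of_lt (Finset.mem_range.1 hmn)) h
        rw [Set.mem_singleton_iff, ← M.label_path η hm, ← M.label_path η' hm, this]
    _ = ENNReal.ofReal (pathMass p η n) := by
        rw [pathLaw, Measure.infinitePi_pi _ fun _ _ => MeasurableSet.singleton _, pathMass,
          ENNReal.ofReal_prod_of_nonneg fun m _ => hp.1 _]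
        exact Finset.prod_congr rfl fun m _ => labelLaw_singleton hp _

/-- A set of diameter at most `2 ^ (-n)` meets few cubes of generation `n`, hence has a small mass
if the masses of the cubes are small. -/
lemma pathLaw_preimage_le (M : RCM d Ω) {p : Ω → ℝ} (hp : p ∈ stdSimplex ℝ Ω) {t : ℝ} {n : ℕ}
    {G : Set (ℕ → Ω)} (hG : ∀ η ∈ G, pathMass p η n ≤ 2 ^ (-(n * t : ℝ)))
    {s : Set (EuclideanSpace ℝ (Fin d))} (hs : Metric.ediam s ≤ ENNReal.ofReal (1 / 2 ^ n)) :
    pathLaw hp ((fun η => point (M.pathDigits η)) ⁻¹' s ∩ G) ≤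
      ENNReal.ofReal (4 ^ d * 2 ^ (-(n * t : ℝ))) := by
  classical
  set J : Finset (Fin n → Digit d) := Finset.univ.filter fun j =>
    ∃ η ∈ G, point (M.pathDigits η) ∈ s ∧ M.path η n = List.ofFn j with hJ
  have hcard : J.card ≤ 4 ^ d := by
    refine card_cubes_meeting_le n s (fun x hx y hy => ?_) J fun j hj => ?_
    · have := (Metric.edist_le_ediam_of_mem hx hy).trans hs
      rwa [edist_dist, ENNReal.ofReal_le_ofReal_iff (by positivity)] at this
    · obtain ⟨η, -, hηs, hη⟩ := (Finset.mem_filter.1 hj).2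
      refine ⟨_, ?_, hηs⟩
      rw [← hη, path_eq_branch]
      exact point_mem_cube _ n
  have hsub : (fun η => point (M.pathDigits η)) ⁻¹' s ∩ G ⊆
      ⋃ j ∈ J, {η | M.path η n = List.ofFn j} := by
    rintro η ⟨hηs, hηG⟩
    have e : M.path η n = List.ofFn fun m : Fin n => M.pathDigits η m := M.path_eq_branch η n
    exact Set.mem_iUnion₂.2 ⟨_, Finset.mem_filter.2 ⟨Finset.mem_univ _, η, hηG, hηs, e⟩, e⟩
  calc pathLaw hp ((fun η => point (M.pathDigits η)) ⁻¹' s ∩ G)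
      ≤ ∑ j ∈ J, pathLaw hp {η | M.path η n = List.ofFn j} :=
        (measure_mono hsub).trans (measure_biUnion_finset_le _ _)
    _ ≤ ∑ _j ∈ J, ENNReal.ofReal (2 ^ (-(n * t : ℝ))) := by
        refine Finset.sum_le_sum fun j hj => ?_
        obtain ⟨η, hηG, -, hη⟩ := (Finset.mem_filter.1 hj).2
        rw [← hη]
        exact (M.pathLaw_path_eq_le hp η n).trans (ENNReal.ofReal_le_ofReal (hG η hηG))
    _ = J.card * ENNReal.ofReal (2 ^ (-(n * t : ℝ))) := by simp
    _ ≤ ((4 ^ d : ℕ) : ENNReal) * ENNReal.ofReal (2 ^ (-(n * t : ℝ))) := by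
        gcongr
    _ = ENNReal.ofReal (4 ^ d * 2 ^ (-(n * t : ℝ))) := by
        rw [ENNReal.ofReal_mul (by positivity)]
        congr 1
        rw [← ENNReal.ofReal_natCast]
        simp

end Probability

lemma mem_E_of_tendsto (M : RCM d Ω) (X : Coding d) {a : ℝ} {p : Ω → ℝ} (hp : p ∈ M.level a)
    {x : EuclideanSpace ℝ (Fin d)} (hx : x ∈ X.dom)
    (h : Tendsto (fun n : ℕ => M.freq (X.node x n)) atTop (𝓝 p)) : x ∈ M.E X a := by
  refine ⟨hx, fun q hq => ?_⟩
  have : q = p := by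
    have hq' : ClusterPt q (map (fun n : ℕ => M.freq (X.node x n)) atTop) := hq
    exact eq_of_nhds_neBot (hq'.mono h)
  rwa [this]

lemma point_path_mem_E (M : RCM d Ω) (X : Coding d) {a : ℝ} {p : Ω → ℝ} (hp : p ∈ M.level a)
    {η : ℕ → Ω} (h : ∀ g : Ω → ℝ, Tendsto (fun n : ℕ => (∑ m ∈ Finset.range n, g (η m)) / n) atTop
      (𝓝 (∑ ω, p ω * g ω))) : point (M.pathDigits η) ∈ M.E X a := by
  classical
  have hgen := M.generic_path η
  refine M.mem_E_of_tendsto X hp (X.mem_dom_of_generic hgen) (tendsto_pi_nhds.2 fun ω => ?_)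
  have h1 := M.tendsto_labelSum_path (h (Pi.single ω 1))
  have e (q : Ω → ℝ) : ∑ v, q v * (Pi.single ω 1 : Ω → ℝ) v = q ω := by simp [Pi.single_apply]
  rw [e] at h1
  refine h1.congr fun n => ?_
  rw [X.node_point hgen, ← path_eq_branch, ← e (M.freq _), sum_freq_mul, length_path]

/-- The local bound `ν s ≤ C * diam s ^ t` of the mass distribution principle, from the bounds for
the sets of diameter `2 ^ (-n)`. -/
lemma le_mul_ediam_rpow {c : ENNReal} {K t : ℝ} {n₀ : ℕ} {x : ENNReal} (hK : 0 ≤ K) (ht : 0 < t)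
    (hx : x ≤ ENNReal.ofReal (1 / 2 ^ n₀))
    (h : ∀ n ≥ n₀, x ≤ ENNReal.ofReal (1 / 2 ^ n) →
      c ≤ ENNReal.ofReal (K * 2 ^ (-(n * t : ℝ)))) :
    c ≤ ENNReal.ofReal (K * 2 ^ t) * x ^ t := by
  obtain ⟨y, hy0, rfl⟩ : ∃ y : ℝ, 0 ≤ y ∧ x = ENNReal.ofReal y :=
    ⟨x.toReal, ENNReal.toReal_nonneg,
      (ENNReal.ofReal_toReal (ne_top_of_le_ne_top ENNReal.ofReal_ne_top hx)).symm⟩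
  have hpow (n : ℕ) : (1 / 2 ^ n : ℝ) = (1 / 2) ^ n := by rw [div_pow, one_pow]
  rcases hy0.eq_or_lt with rfl | hy
  · -- A set of diameter `0` satisfies the bounds for all `n`, so it has no mass.
    have hlim : Tendsto (fun n : ℕ => ENNReal.ofReal (K * 2 ^ (-(n * t : ℝ)))) atTop (𝓝 0) := by
      have h1 : Tendsto (fun n : ℕ => (2 : ℝ) ^ (-(n * t : ℝ))) atTop (𝓝 0) :=
        (tendsto_rpow_atBot_of_base_gt_one 2 (by norm_num)).comp
          (tendsto_neg_atTop_atBot.comp (tendsto_natCast_atTop_atTop.atTop_mul_const ht))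
      simpa using ENNReal.tendsto_ofReal (h1.const_mul K)
    have h0 : c ≤ 0 := ge_of_tendsto hlim <| by
      filter_upwards [eventually_ge_atTop n₀] with n hn
      exact h n hn (by simp)
    exact h0.trans zero_le
  · rw [ENNReal.ofReal_le_ofReal_iff (by positivity)] at hx
    have hy1 : y ≤ 1 := hx.trans (by rw [hpow]; exact pow_le_one₀ (by norm_num) (by norm_num))
    obtain ⟨n, hn1, hn2⟩ := exists_nat_pow_near_of_lt_one hy hy1 (y := (1 / 2 : ℝ)) (by norm_num)
      (by norm_num)
    have hn : n₀ ≤ n := by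
      by_contra! hlt
      have h1 : (1 / 2 : ℝ) ^ n₀ ≤ (1 / 2) ^ (n + 1) :=
        pow_le_pow_of_le_one (by norm_num) (by norm_num) hlt
      rw [hpow] at hx
      linarith
    refine (h n hn (ENNReal.ofReal_le_ofReal (by rwa [hpow]))).trans ?_
    rw [ENNReal.ofReal_rpow_of_pos hy, ← ENNReal.ofReal_mul (by positivity)]
    refine ENNReal.ofReal_le_ofReal ?_
    rw [mul_assoc]
    refine mul_le_mul_of_nonneg_left ?_ hK
    have e : (2 : ℝ) ^ (-(n * t : ℝ)) = 2 ^ t * ((1 / 2) ^ (n + 1)) ^ t := by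
      rw [one_div, inv_pow, Real.inv_rpow (by positivity), ← Real.rpow_natCast,
        ← Real.rpow_mul (by norm_num), ← Real.rpow_neg (by norm_num),
        ← Real.rpow_add (by norm_num)]
      push_cast
      ring_nf
    rw [e]
    gcongr

/-- Every vector of the level bounds the dimension from below by its entropy: independent labels
with this law give a measure on the level set to which the mass distribution principle applies. -/
lemma entropy_le_dimH_E (M : RCM d Ω) (X : Coding d) {a : ℝ} {p : Ω → ℝ} (hp : p ∈ M.level a) :
    ENNReal.ofReal (entropy p) ≤ dimH (M.E X a) := by
  let _ : MeasurableSpace Ω := ⊤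
  have : DiscreteMeasurableSpace Ω := ⟨fun _ => trivial⟩
  refine le_of_forall_lt fun r hr => ?_
  obtain ⟨t, hrt, htH⟩ := ENNReal.lt_iff_exists_nnreal_btwn.1 hr
  refine hrt.trans_le ?_
  have ht0 : (0 : ℝ) < t := by
    have : (0 : ENNReal) < t := (zero_le).trans_lt hrt
    exact_mod_cast this
  have htH' : (t : ℝ) < entropy p := by
    rw [← ENNReal.ofReal_coe_nnreal] at htH
    exact (ENNReal.ofReal_lt_ofReal_iff_of_nonneg t.coe_nonneg).1 htH
  -- Almost every sequence of labels has all its asymptotic means determined by `p`.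
  have hae : ∀ᵐ η ∂(pathLaw hp.1), ∀ g : Ω → ℝ,
      Tendsto (fun n : ℕ => (∑ m ∈ Finset.range n, g (η m)) / n) atTop (𝓝 (∑ ω, p ω * g ω)) := by
    classical
    filter_upwards [ae_all_iff.2 fun ω : Ω => ae_tendsto_mean hp.1 (Pi.single ω 1)] with η hη g
    have h1 := tendsto_finsetSum Finset.univ fun ω _ => (hη ω).mul_const (g ω)
    have e (v : Ω) : ∑ ω, (Pi.single ω 1 : Ω → ℝ) v * g ω = g v := by simp [Pi.single_apply]
    have e' (ω : Ω) : ∑ v, p v * (Pi.single ω 1 : Ω → ℝ) v = p ω := by simp [Pi.single_apply]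
    simp only [e'] at h1
    refine h1.congr fun n => ?_
    simp_rw [div_mul_eq_mul_div, ← Finset.sum_div, Finset.sum_mul]
    rw [Finset.sum_comm]
    simp_rw [e]
  set G : ℕ → Set (ℕ → Ω) := fun n₀ => {η | (∀ g : Ω → ℝ,
      Tendsto (fun n : ℕ => (∑ m ∈ Finset.range n, g (η m)) / n) atTop (𝓝 (∑ ω, p ω * g ω))) ∧
      ∀ n ≥ n₀, pathMass p η n ≤ 2 ^ (-(n * t : ℝ))} with hG
  obtain ⟨n₀, hn₀⟩ : ∃ n₀, pathLaw hp.1 (G n₀) ≠ 0 := by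
    by_contra! h0
    have h1 : ∀ᵐ η ∂(pathLaw hp.1), η ∈ ⋃ n, G n := by
      filter_upwards [hae] with η hη
      have h2 := hη fun ω => Real.logb 2 (p ω)
      rw [← neg_neg (∑ ω, p ω * Real.logb 2 (p ω))] at h2
      obtain ⟨n₀, h3⟩ := eventually_atTop.1 (eventually_pathMass_le hp.1.1 htH' h2)
      exact Set.mem_iUnion.2 ⟨n₀, hη, h3⟩
    have h2 : ∀ᵐ η ∂(pathLaw hp.1), η ∉ ⋃ n, G n :=
      measure_eq_zero_iff_ae_notMem.1 (measure_iUnion_null h0)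
    have h3 : ∀ᵐ _η ∂(pathLaw hp.1), False := by
      filter_upwards [h1, h2] with η h4 h5 using h5 h4
    have hprob : IsProbabilityMeasure (pathLaw hp.1) := by unfold pathLaw; infer_instance
    exact h3.exists.elim fun _ h => h
  set Φ : (ℕ → Ω) → EuclideanSpace ℝ (Fin d) := fun η => point (M.pathDigits η) with hΦ
  have hΦm : Measurable Φ := M.measurable_point_path
  refine le_dimH_of_measure_le (((pathLaw hp.1).restrict (G n₀)).map Φ) t
    (C := ENNReal.ofReal (4 ^ d * 2 ^ (t : ℝ))) (ε := ENNReal.ofReal (1 / 2 ^ n₀)) ?_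
    ENNReal.ofReal_ne_top (by simp) (fun s hs hdiam => ?_) ?_
  · rw [ne_eq, ENNReal.ofReal_eq_zero, not_le]
    positivity
  · rw [Measure.map_apply hΦm hs.measurableSet, Measure.restrict_apply (hΦm hs.measurableSet)]
    exact le_mul_ediam_rpow (by positivity) ht0 hdiam fun n hn hd =>
      M.pathLaw_preimage_le hp.1 (fun η hη => hη.2 n hn) hd
  · refine ne_of_gt (lt_of_lt_of_le (pos_iff_ne_zero.2 hn₀) ?_)
    calc pathLaw hp.1 (G n₀) = (pathLaw hp.1).restrict (G n₀) (G n₀) :=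
          (Measure.restrict_apply_self _ _).symm
      _ ≤ (pathLaw hp.1).restrict (G n₀) (Φ ⁻¹' M.E X a) :=
          measure_mono fun η hη => M.point_path_mem_E X hp hη.1
      _ ≤ _ := Measure.le_map_apply hΦm.aemeasurable _

lemma dimH_E (M : RCM d Ω) (X : Coding d) {a : ℝ} {p : Ω → ℝ} (hp : p ∈ M.level a)
    (h : ∀ ε > 0, ∃ γ, M.pressure γ - γ * a < entropy p + ε) :
    dimH (M.E X a) = ENNReal.ofReal (entropy p) := by
  refine le_antisymm ?_ (M.entropy_le_dimH_E X hp)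
  refine ENNReal.le_of_forall_pos_le_add fun ε hε _ => ?_
  obtain ⟨γ, hγ⟩ := h ε hε
  refine (M.dimH_E_le_pressure X a γ).trans ?_
  refine (ENNReal.ofReal_le_ofReal hγ.le).trans ?_
  rw [ENNReal.ofReal_add (entropy_nonneg hp.1) ε.coe_nonneg, ENNReal.ofReal_coe_nnreal]

end RCM

end DyadicTree

namespace DyadicTree

namespace RCM

variable {d : ℕ} {Ω : Type*} [Fintype Ω]

lemma not_flat_of_lt (M : RCM d Ω) (h : M.ellBot < M.ellTop) : ¬ M.Flat := by
  intro hM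
  have := M.nonempty_label
  obtain ⟨ω, hω⟩ := exists_eq_ciInf_of_finite (f := fun ω => Real.logb 2 (M.δ ω))
  obtain ⟨ω', hω'⟩ := exists_eq_ciSup_of_finite (f := fun ω => Real.logb 2 (M.δ ω))
  rw [ellBot, ellTop, ← hω, ← hω', hM ω ω'] at h
  exact h.false

lemma Delta_eq (M : RCM d Ω) : M.Delta = entropy (M.gibbs (3 / 2)) := by
  rw [entropy_gibbs, Delta, mul_sub, mul_ell]
  ring

end RCM

end DyadicTree

theorem mainTheorem8 {d : ℕ} {Ω : Type*} [Fintype Ω] (M : DyadicTree.RCM d Ω)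
    (X : DyadicTree.Coding d) :
    -- the dimension of `E(𝕊_a)` is `𝒟(a)`, the maximal entropy on `𝕊_a`
    (∀ a ∈ Set.Icc M.ellBot M.ellTop,
      IsGreatest (DyadicTree.entropy '' M.level a) (M.D a) ∧
      dimH (M.E X a) = ENNReal.ofReal (M.D a)) ∧
    -- the explicit form of `𝒟(a)`, in the non-flat and in the flat case
    (∀ a ∈ Set.Ioo M.ellBot M.ellTop, ∃ γ : ℝ,
      (∀ γ' : ℝ, M.phi γ' = a ↔ γ' = γ) ∧ M.D a = d - γ * (a - M.ell γ)) ∧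
    (M.Flat → M.ellBot = M.ellTop ∧ M.D M.ellBot = d) ∧
    -- `φ(3/2)` is the value of `σ` that carries all anomalous dissipation of the constant solution
    (∀ (α f : ℝ), 0 < α → 0 < f → ∀ u : DyadicTree.Node d → ℝ,
      M.IsConstantSolution α f u → (∃ s : ℝ, DyadicTree.MemH s u) →
      ∀ a : ℝ, M.CarriesDissipation α f u a ↔ a = M.phi (3 / 2)) ∧
    -- the dimension of the set where anomalous dissipation occurs
    0 ≤ M.Delta ∧
    dimH (M.E X (M.phi (3 / 2))) = ENNReal.ofReal M.Delta ∧
    (¬ M.Flat → M.Delta < d) := by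
  refine ⟨fun a ha => ?_, fun a ha => ?_, fun hM => ?_, fun α f _ hf u hu hs a =>
    hu.carriesDissipation_iff hf hs a, ?_, ?_, fun hM => ?_⟩
  · obtain ⟨p, hp, h⟩ := M.exists_entropy_eq ha
    have hD : M.D a = DyadicTree.entropy p := (M.isGreatest_entropy hp h).csSup_eq
    rw [hD]
    exact ⟨M.isGreatest_entropy hp h, M.dimH_E X hp h⟩
  · obtain ⟨γ, rfl⟩ := M.exists_phi_eq ha
    refine ⟨γ, fun γ' => (M.phi_injective (M.not_flat_of_lt (ha.1.trans ha.2))).eq_iff, ?_⟩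
    rw [M.D_phi, mul_sub, M.mul_ell]
    ring
  · have heq : M.ellBot = M.ellTop := by
      by_contra h
      have hle := (M.phi_mem 0).1.trans (M.phi_mem 0).2
      exact M.not_flat_of_lt (hle.lt_of_ne h) hM
    refine ⟨heq, ?_⟩
    have h0 : M.ellBot = M.phi 0 := le_antisymm (M.phi_mem 0).1 (heq ▸ (M.phi_mem 0).2)
    rw [h0, M.D_phi, M.pressure_zero]
    ring
  · rw [M.Delta_eq]
    exact DyadicTree.entropy_nonneg (M.gibbs_mem_level _).1
  · rw [M.Delta_eq]
    exact M.dimH_E X (M.gibbs_mem_level _) fun ε hε =>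
      ⟨3 / 2, by rw [M.entropy_gibbs]; linarith⟩
  · rw [M.Delta_eq]
    exact M.entropy_gibbs_lt hM (by norm_num)
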